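/- Let $d\ge 1$, $1<p\le q<\infty$, $0<\alpha<d$, and let $p'=p/(p-1)$. A weight on $\mathbb{R}^d$ is a locally integrable function $w$ with $0<w(x)<\infty$ for almost every $x$; $L^p(w)$ is the Lebesgue space of the measure $w(x)\,dx$. Suprema over $Q$ run over all cubes $Q=[x_1,x_1+l[\,\times\dots\times[x_d,x_d+l[$, $l>0$. Write $(v,w)\in A^\alpha_{p,q}$ if $$\sup_Q |Q|^{\frac{\alpha}{d}-1}\Big(\int_Q v^{-p'/p}\Big)^{1/p'}\Big(\int_Q w\Big)^{1/q}<\infty,$$ and $w\in A_\infty$ if $w$ is a weight and $$\sup_Q \exp\Big(\frac1{|Q|}\int_Q\log(w^{-1})\Big)\frac1{|Q|}\int_Q w<\infty .$$ Let $\mathcal I_\alpha f(x)=\int_{\mathbb{R}^d}|y|^{\alpha-d}f(x-y)\,dy$. **Theorem.** Let $v,w$ be weights such that $(v,w)\in A^\alpha_{p,q}$ and $v^{-p'/p},\,w\in A_\infty$. Then there is a constant $C$, independent of $f$, such that for every $f\in L^p(v)$ the integral $\mathcal I_\alpha f(x)$ converges absolutely for almost every $x$, and $\mathcal I_\alpha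 f\in L^q(w)$ with $$\|\mathcal I_\alpha f\|_{L^q(w)}\le C\,\|f\|_{L^p(v)} .$$ This generalizes the Stein–Weiss inequality: if $-\frac dq<\gamma\le\beta<\frac d{p'}$ and $\frac1q+\frac\alpha d+\frac\gamma d=\frac1p+\frac\beta d$, then $v=|x|^{\beta p}$ and $w=|x|^{\gamma q}$ are weights that satisfy all the hypotheses above, and there is a constant $C$ such that, for every $f$ with $|x|^\beta f\in L^p(\mathbb{R}^d)$, the integral $\mathcal I_\alpha f(x)$ converges absolutely for almost every $x$, $|x|^\gamma\mathcal I_\alpha f\in L^q(\mathbb{R}^d)$, and $$\||x|^\gamma\mathcal I_\alpha f\|_{L^q(\mathbb{R}^d)}\le C\,\||x|^\beta f\|_{L^p(\mathbb{R}^d)} .$$ -/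

import Mathlib

open MeasureTheory
open scoped ENNReal NNReal

noncomputable section

/-- The half-open cube `[x₁, x₁ + l[ × ⋯ × [x_d, x_d + l[` with corner `x` and sidelength `l`,
with sides parallel to the coordinate axes. -/
def cube {d : ℕ} (x : EuclideanSpace ℝ (Fin d)) (l : ℝ) : Set (EuclideanSpace ℝ (Fin d)) :=
  {y | ∀ i, x i ≤ y i ∧ y i < x i + l}

/-- A weight: a locally integrable function which is positive (and finite) almost everywhere. -/
def IsWeight {d : ℕ} (w : EuclideanSpace ℝ (Fin d) → ℝ) : Prop :=
  LocallyIntegrable w volume ∧ ∀ᵐ x, 0 < w x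

/-- The measure `w(x) dx`. -/
def weightMeasure {d : ℕ} (w : EuclideanSpace ℝ (Fin d) → ℝ) :
    Measure (EuclideanSpace ℝ (Fin d)) :=
  volume.withDensity fun x => ENNReal.ofReal (w x)

/-- The dual weight `v ^ (-p' / p)`, where `p' = p / (p - 1)`. -/
def dualWeight {d : ℕ} (p : ℝ) (v : EuclideanSpace ℝ (Fin d) → ℝ) :
    EuclideanSpace ℝ (Fin d) → ℝ :=
  fun x => v x ^ (-(p.conjExponent / p))

/-- The constant
`sup_Q |Q|^(α/d - 1) (∫_Q v^(-p'/p))^(1/p') (∫_Q w)^(1/q)`, with values in `[0, ∞]`;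
the supremum runs over all cubes. -/
def apqConst {d : ℕ} (p q α : ℝ) (v w : EuclideanSpace ℝ (Fin d) → ℝ) : ℝ≥0∞ :=
  ⨆ (x : EuclideanSpace ℝ (Fin d)) (l : ℝ) (_ : 0 < l),
    volume (cube x l) ^ (α / d - 1)
      * (∫⁻ y in cube x l, ENNReal.ofReal (dualWeight p v y)) ^ (1 / p.conjExponent)
      * (∫⁻ y in cube x l, ENNReal.ofReal (w y)) ^ (1 / q)

/-- The pair `(v, w)` satisfies the `A_{p,q}^α` condition. -/
def IsApq {d : ℕ} (p q α : ℝ) (v w : EuclideanSpace ℝ (Fin d) → ℝ) : Prop :=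
  apqConst p q α v w < ∞

/-- The weight `w` belongs to `A_∞`:
`sup_Q exp (⨍_Q log (w⁻¹)) ⨍_Q w < ∞`. For a weight, `log w` is bounded above by `w`, so
`⨍_Q log (w⁻¹)` always makes sense in `]-∞, ∞]`, and it is finite if and only if `log (w⁻¹)` is
integrable on `Q`; hence finiteness of the supremum includes this integrability. -/
def IsAInfty {d : ℕ} (w : EuclideanSpace ℝ (Fin d) → ℝ) : Prop :=
  IsWeight w ∧ ∃ C : ℝ, ∀ (x : EuclideanSpace ℝ (Fin d)) (l : ℝ), 0 < l →
    IntegrableOn (fun y => Real.log (w y)⁻¹) (cube x l) volume ∧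
    Real.exp (⨍ y in cube x l, Real.log (w y)⁻¹) * ⨍ y in cube x l, w y ≤ C

/-- The integrand `|y|^(α - d) f(x - y)` of the Riesz potential at the point `x`. -/
def rieszIntegrand {d : ℕ} (α : ℝ) (f : EuclideanSpace ℝ (Fin d) → ℂ)
    (x : EuclideanSpace ℝ (Fin d)) : EuclideanSpace ℝ (Fin d) → ℂ :=
  fun y => ((‖y‖ ^ (α - d) : ℝ) : ℂ) * f (x - y)

/-- The Riesz potential `I_α f(x) = ∫ |y|^(α - d) f(x - y) dy`. -/
def rieszPotential {d : ℕ} (α : ℝ) (f : EuclideanSpace ℝ (Fin d) → ℂ)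
    (x : EuclideanSpace ℝ (Fin d)) : ℂ :=
  ∫ y, rieszIntegrand α f x y

/-- The power weight `|x|^a`. -/
def powerWeight {d : ℕ} (a : ℝ) : EuclideanSpace ℝ (Fin d) → ℝ :=
  fun x => ‖x‖ ^ a

end

/-! The kernel |x - y|^(α-d) is dominated, up to a constant, by 2^d dyadic kernels Σ_Q l(Q)^(α-d)
1_Q(x) 1_Q(y), one for each product of plain and shifted one-dimensional grids (the one-third trick,
`ofReal_norm_sub_rpow_le`). It is therefore enough to bound one dyadic operator. Put σ = v^(-p'/p),
ω = w dx and |f| = g σ. Since v = σ^(1-p), the norm of f in L^p(v) is that of g in L^p(σ), and by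
duality the question is to bound the form Σ_Q l(Q)^(α-d) ∫_Q g dσ ∫_Q k dω.

In this form only principal cubes matter: those chosen so that the Lebesgue average of gσ more than
doubles from a principal cube to a smaller one inside it. The other cubes are absorbed, because α >
0 makes the sum of l(Q)^α 1_Q over the cubes Q inside a fixed one geometric (`sum_principal_le`).
The doubling forces sparseness: the smaller principal cubes cover at most half of the volume of each
(`measure_le_two_mul_core`). The A_∞ hypotheses serve only to carry this from volume to σ and to ω
(`IsAInfty.exists_measure_le`).

On a principal cube, the A_{p,q}^α constant is split off, which leaves σ(Q)^(1/p) A_Q · ω(Q)^(1/q')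
B_Q with A_Q, B_Q the averages of g and k in their own measures. Hölder's inequality, the embedding
of ℓ^(q') in ℓ^(p') (here p ≤ q enters) and the Carleson embedding theorem for σ and for ω conclude
(`TwoWeight.sum_mul_le`).

For power weights everything follows from the single estimate ∫_Q |y|^a dy ≤ C l^d (l + |x|)^a,
where a > -d and Q has corner x and side l. -/

open MeasureTheory
open scoped ENNReal NNReal

/-! ### Laminar families of sets -/

/-- A family of measurable sets `Q i`, with levels `lev i`, any two of which are either disjoint
or nested; in the nested case the larger set has the larger level. -/
structure IsLaminar {X ι : Type*} [MeasurableSpace X] (Q : ι → Set X) (lev : ι → ℤ) : Prop where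
  measurableSet : ∀ i, MeasurableSet (Q i)
  disjoint_or_subset : ∀ i j, lev i ≤ lev j → i ≠ j →
    Disjoint (Q i) (Q j) ∨ (lev i < lev j ∧ Q i ⊆ Q j)

namespace IsLaminar

variable {X ι : Type*} [MeasurableSpace X] {Q : ι → Set X} {lev : ι → ℤ}

/-- A set of lowest level is either contained in another one, and then does not change the union, or
is disjoint from all of them, and then both sides are additive. No covering lemma and no constant is
needed. -/
theorem measure_biUnion_le (h : IsLaminar Q lev) (F : Finset ι) (μ ν : Measure X)
    (hF : ∀ i ∈ F, μ (Q i) ≤ ν (Q i)) : μ (⋃ i ∈ F, Q i) ≤ ν (⋃ i ∈ F, Q i) := by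
  classical
  induction F using Finset.induction_on_min_value lev with
  | empty => simp
  | insert a s has hmin ih =>
    have ih' := ih fun i hi => hF i (Finset.mem_insert_of_mem hi)
    rw [Finset.set_biUnion_insert]
    by_cases hsub : ∃ j ∈ s, Q a ⊆ Q j
    · obtain ⟨j, hj, haj⟩ := hsub
      rw [Set.union_eq_self_of_subset_left (haj.trans (Set.subset_iUnion₂_of_subset j hj subset_rfl))]
      exact ih'
    · have hd : Disjoint (Q a) (⋃ i ∈ s, Q i) := by
        rw [Set.disjoint_iUnion₂_right]
        intro j hj
        rcases h.disjoint_or_subset a j (hmin j hj) (fun e => has (e ▸ hj)) with hd | ⟨-, hd⟩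
        · exact hd
        · exact absurd ⟨j, hj, hd⟩ hsub
      have hm : MeasurableSet (⋃ i ∈ s, Q i) :=
        Finset.measurableSet_biUnion s fun i _ => h.measurableSet i
      rw [measure_union hd hm, measure_union hd hm]
      exact add_le_add (hF a (Finset.mem_insert_self _ _)) ih'

/-- Selection of principal sets. -/
theorem exists_principal {X ι : Type*} (Q : ι → Set X) (lev : ι → ℤ) (F : Finset ι) (a : ι → ℝ≥0∞) :
    ∃ S ⊆ F, (∀ i ∈ F, ∃ j ∈ S, lev i ≤ lev j ∧ Q i ⊆ Q j ∧ a i ≤ 2 * a j) ∧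
      ∀ i ∈ S, ∀ j ∈ S, lev i < lev j → Q i ⊆ Q j → 2 * a j < a i := by
  classical
  induction F using Finset.induction_on_min_value lev with
  | empty => exact ⟨∅, by simp⟩
  | insert b s hbs hmin ih =>
    obtain ⟨S, hS, h1, h2⟩ := ih
    -- Sets arrive by decreasing level, so `b` can only lie below the chosen ones; it is chosen
    -- exactly when none of them dominates it.
    by_cases hb : ∃ j ∈ S, lev b ≤ lev j ∧ Q b ⊆ Q j ∧ a b ≤ 2 * a j
    · refine ⟨S, hS.trans (Finset.subset_insert _ _), ?_, h2⟩
      intro i hi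
      rcases Finset.mem_insert.1 hi with rfl | hi
      · exact hb
      · exact h1 i hi
    · refine ⟨insert b S, Finset.insert_subset_insert _ hS, ?_, ?_⟩
      · intro i hi
        rcases Finset.mem_insert.1 hi with rfl | hi
        · refine ⟨i, Finset.mem_insert_self _ _, le_rfl, subset_rfl, ?_⟩
          rw [two_mul]
          exact le_self_add
        · obtain ⟨j, hj, hh⟩ := h1 i hi
          exact ⟨j, Finset.mem_insert_of_mem hj, hh⟩
      · intro i hi j hj hlt hsub
        rcases Finset.mem_insert.1 hj with rfl | hj'
        · rcases Finset.mem_insert.1 hi with rfl | hi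
          · exact absurd hlt (lt_irrefl _)
          · exact absurd hlt (not_lt.2 (hmin i (hS hi)))
        · rcases Finset.mem_insert.1 hi with rfl | hi
          · push Not at hb
            exact hb j hj' hlt.le hsub
          · exact h2 i hi j hj' hlt hsub

/-- The part of `Q j` which is not covered by smaller sets of the family. -/
def core {X ι : Type*} (Q : ι → Set X) (lev : ι → ℤ) (S : Finset ι) (j : ι) : Set X :=
  Q j \ ⋃ i ∈ (open Classical in S.filter fun i => lev i < lev j ∧ Q i ⊆ Q j), Q i

theorem core_subset {X ι : Type*} {Q : ι → Set X} {lev : ι → ℤ} (S : Finset ι) (j : ι) : core Q lev S j ⊆ Q j := Set.sdiff_subset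

theorem measurableSet_core (h : IsLaminar Q lev) (S : Finset ι) (j : ι) :
    MeasurableSet (core Q lev S j) :=
  (h.measurableSet j).diff (Finset.measurableSet_biUnion _ fun i _ => h.measurableSet i)

theorem disjoint_core (h : IsLaminar Q lev) (S : Finset ι) :
    (S : Set ι).PairwiseDisjoint (core Q lev S) := by
  have key : ∀ i ∈ S, ∀ j ∈ S, i ≠ j → lev i ≤ lev j →
      Disjoint (core Q lev S i) (core Q lev S j) := by
    intro i hi j hj hij hle
    rcases h.disjoint_or_subset i j hle hij with hd | hd
    · exact hd.mono (core_subset S i) (core_subset S j)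
    · refine Set.disjoint_left.2 fun x hx hx' => hx'.2 ?_
      simp only [Set.mem_iUnion]
      exact ⟨i, by simp [hi, hd], hx.1⟩
  intro i hi j hj hij
  rcases le_total (lev i) (lev j) with hle | hle
  · exact key i hi j hj hij hle
  · exact (key j hj i hi hij.symm hle).symm

/-- Sparseness of principal sets. On the union U of the smaller ones inside Q j the density of ν is
at least twice its average on Q j, so 2 (ν(Q j)/μ(Q j)) μ(U) ≤ ν(U) ≤ ν(Q j), that is, 2 μ(U) ≤ μ(Q
j). -/
theorem measure_le_two_mul_core (h : IsLaminar Q lev) (S : Finset ι) (μ ν : Measure X)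
    (hμ0 : ∀ i, μ (Q i) ≠ 0) (hμ : ∀ i, μ (Q i) ≠ ∞) (hν : ∀ i, ν (Q i) ≠ ∞)
    (hS : ∀ i ∈ S, ν (Q i) ≠ 0)
    (hS2 : ∀ i ∈ S, ∀ j ∈ S, lev i < lev j → Q i ⊆ Q j →
      2 * (ν (Q j) / μ (Q j)) < ν (Q i) / μ (Q i)) (j : ι) (hj : j ∈ S) :
    μ (Q j) ≤ 2 * μ (core Q lev S j) := by
  classical
  set T := S.filter fun i => lev i < lev j ∧ Q i ⊆ Q j with hT
  set U := ⋃ i ∈ T, Q i with hU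
  have hUm : MeasurableSet U := Finset.measurableSet_biUnion _ fun i _ => h.measurableSet i
  have hUQ : U ⊆ Q j := Set.iUnion₂_subset fun i hi => (Finset.mem_filter.1 hi).2.2
  have h1 : ((2 * (ν (Q j) / μ (Q j))) • μ) U ≤ ν U := by
    refine h.measure_biUnion_le T _ _ fun i hi => ?_
    obtain ⟨hiS, hlt, hsub⟩ := Finset.mem_filter.1 hi
    have := (hS2 i hiS j hj hlt hsub).le
    rw [Measure.smul_apply, smul_eq_mul]
    exact (ENNReal.le_div_iff_mul_le (Or.inl (hμ0 i)) (Or.inl (hμ i))).1 this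
  rw [Measure.smul_apply, smul_eq_mul] at h1
  have h2 : 2 * μ U ≤ μ (Q j) := by
    have h3 : ν (Q j) / μ (Q j) * (2 * μ U) ≤ ν (Q j) / μ (Q j) * μ (Q j) := by
      rw [ENNReal.div_mul_cancel (hμ0 j) (hμ j)]
      calc _ = 2 * (ν (Q j) / μ (Q j)) * μ U := by ring
        _ ≤ ν U := h1
        _ ≤ ν (Q j) := measure_mono hUQ
    exact (ENNReal.mul_le_mul_iff_right (ENNReal.div_ne_zero.2 ⟨hS j hj, hμ j⟩)
      (ENNReal.div_ne_top (hν j) (hμ0 j))).1 h3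
  have hUt : μ U ≠ ∞ := ne_top_of_le_ne_top (hμ j) (measure_mono hUQ)
  have h4 : μ (Q j) = μ (core Q lev S j) + μ U := by
    rw [← measure_sdiff_add_inter (Q j) hUm, Set.inter_eq_self_of_subset_right hUQ]
    rfl
  rw [two_mul] at h2
  have h5 : μ U ≤ μ (core Q lev S j) := by
    rw [h4] at h2
    exact (ENNReal.add_le_add_iff_right hUt).1 h2
  rw [h4, two_mul]
  gcongr

end IsLaminar

/-! ### Geometric sums, the maximal function and Carleson embedding -/

namespace IsLaminar

variable {X ι : Type*} [MeasurableSpace X] {Q : ι → Set X} {lev : ι → ℤ}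

theorem sum_measure_le_of_lev_eq (h : IsLaminar Q lev) (T : Finset ι) (H : Measure X) (n : ℤ)
    (hT : ∀ i ∈ T, lev i = n) (B : Set X) (hB : ∀ i ∈ T, Q i ⊆ B) :
    ∑ i ∈ T, H (Q i) ≤ H B := by
  rw [← measure_biUnion_finset _ fun i _ => h.measurableSet i]
  · exact measure_mono (Set.iUnion₂_subset hB)
  · intro i hi j hj hij
    have hl : lev i = lev j := (hT i hi).trans (hT j hj).symm
    rcases h.disjoint_or_subset i j hl.le hij with hd | hd
    · exact hd
    · exact absurd hd.1 (by simp [hl])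

/-- Sets of one level are disjoint, so the level m steps below Q j contributes at most 2^(-αm) times
the term of Q j; a geometric series remains. -/
theorem sum_lev_rpow_mul_le (h : IsLaminar Q lev) (T : Finset ι) (H : Measure X) {α : ℝ} (j : ι)
    (hT : ∀ i ∈ T, lev i ≤ lev j ∧ Q i ⊆ Q j) :
    ∑ i ∈ T, (2 : ℝ≥0∞) ^ (α * lev i) * H (Q i)
      ≤ (1 - 2 ^ (-α))⁻¹ * ((2 : ℝ≥0∞) ^ (α * lev j) * H (Q j)) := by
  classical
  set n : ι → ℕ := fun i => (lev j - lev i).toNat with hn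
  have hnT : ∀ i ∈ T, (lev i : ℝ) = lev j - n i := by
    intro i hi
    have h1 : ((n i : ℕ) : ℤ) = lev j - lev i := Int.toNat_of_nonneg (by linarith [(hT i hi).1])
    have h2 : ((n i : ℕ) : ℝ) = lev j - lev i := by exact_mod_cast h1
    rw [h2]; ring
  rw [← Finset.sum_fiberwise_of_maps_to (s := T) (t := T.image n) (g := n)
    fun i hi => Finset.mem_image_of_mem n hi]
  have h2 : ∀ m ∈ T.image n, ∑ i ∈ T with n i = m, (2 : ℝ≥0∞) ^ (α * lev i) * H (Q i)
      ≤ (2 ^ (-α)) ^ m * ((2 : ℝ≥0∞) ^ (α * lev j) * H (Q j)) := by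
    intro m _
    calc ∑ i ∈ T with n i = m, (2 : ℝ≥0∞) ^ (α * lev i) * H (Q i)
        = ∑ i ∈ T with n i = m, (2 ^ (-α)) ^ m * (2 : ℝ≥0∞) ^ (α * lev j) * H (Q i) := by
          refine Finset.sum_congr rfl fun i hi => ?_
          obtain ⟨hiT, him⟩ := Finset.mem_filter.1 hi
          congr 1
          rw [hnT i hiT, him, ← ENNReal.rpow_natCast, ← ENNReal.rpow_mul,
            ← ENNReal.rpow_add _ _ (by simp) (by simp)]
          congr 1
          ring
      _ ≤ _ := by
          rw [← Finset.mul_sum, mul_assoc]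
          gcongr
          refine h.sum_measure_le_of_lev_eq _ H (lev j - m) (fun i hi => ?_) _ fun i hi =>
            (hT i (Finset.mem_filter.1 hi).1).2
          obtain ⟨hiT, him⟩ := Finset.mem_filter.1 hi
          have := hnT i hiT
          rw [him] at this
          exact_mod_cast this
  calc _ ≤ ∑ m ∈ T.image n, (2 ^ (-α)) ^ m * ((2 : ℝ≥0∞) ^ (α * lev j) * H (Q j)) :=
        Finset.sum_le_sum h2
    _ ≤ _ := by
        rw [← Finset.sum_mul, ← ENNReal.tsum_geometric]
        gcongr
        exact ENNReal.sum_le_tsum _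

/-- The maximal function of a finite family of sets `Q i` with weights `A i`. -/
noncomputable def maxFun {X ι : Type*} (Q : ι → Set X) (S : Finset ι) (A : ι → ℝ≥0) (x : X) :
    ℝ≥0 :=
  S.sup fun i => (Q i).indicator (fun _ => A i) x

theorem lt_maxFun_iff {X ι : Type*} {Q : ι → Set X} {S : Finset ι} {A : ι → ℝ≥0} {x : X}
    {t : ℝ≥0} : t < maxFun Q S A x ↔ ∃ i ∈ S, t < A i ∧ x ∈ Q i := by
  classical
  rw [maxFun, Finset.lt_sup_iff]
  refine exists_congr fun i => and_congr_right fun _ => ?_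
  by_cases hx : x ∈ Q i <;> simp [hx]

theorem le_maxFun {X ι : Type*} {Q : ι → Set X} {S : Finset ι} {A : ι → ℝ≥0} {x : X} {i : ι}
    (hi : i ∈ S) (hx : x ∈ Q i) : A i ≤ maxFun Q S A x := by
  refine le_trans (le_of_eq ?_) (Finset.le_sup (f := fun i => (Q i).indicator (fun _ => A i) x) hi)
  simp [hx]

theorem measurable_maxFun (h : IsLaminar Q lev) (S : Finset ι) (A : ι → ℝ≥0) :
    Measurable (maxFun Q S A) := by
  refine measurable_of_Ioi fun t => ?_
  have : maxFun Q S A ⁻¹' Set.Ioi t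
      = ⋃ i ∈ (open Classical in S.filter fun i => t < A i), Q i := by
    ext x
    simp [lt_maxFun_iff, and_assoc]
  rw [this]
  exact Finset.measurableSet_biUnion _ fun i _ => h.measurableSet i

/-- Weak-type bound in localized form. If the average on Q i exceeds t, the part of Q i where 2g ≤ t
yields at most half of t σ(Q i), so the part where 2g > t carries the rest. No doubling of σ is
used. -/
theorem mul_measure_lt_maxFun_le (h : IsLaminar Q lev) (S : Finset ι) (A : ι → ℝ≥0)
    (σ : Measure X) (hσ : ∀ i, σ (Q i) ≠ ∞) {g : X → ℝ≥0} (hg : Measurable g)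
    (hA : ∀ i ∈ S, A i * σ (Q i) ≤ ∫⁻ x in Q i, g x ∂σ) (t : ℝ≥0) :
    t * σ {x | t < maxFun Q S A x}
      ≤ (σ.withDensity fun x => ((2 * g x : ℝ≥0) : ℝ≥0∞)) {x | t < 2 * g x} := by
  classical
  set G : Set X := {x | t < 2 * g x} with hG
  have hGm : MeasurableSet G := measurableSet_lt measurable_const (hg.const_mul 2)
  set τ := σ.withDensity fun x => ((2 * g x : ℝ≥0) : ℝ≥0∞) with hτ
  have hset : {x | t < maxFun Q S A x} = ⋃ i ∈ S.filter fun i => t < A i, Q i := by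
    ext x
    simp [lt_maxFun_iff, and_assoc]
  rw [hset]
  have h1 := h.measure_biUnion_le (S.filter fun i => t < A i) ((t : ℝ≥0∞) • σ) (τ.restrict G) ?_
  · rw [Measure.smul_apply, smul_eq_mul] at h1
    refine h1.trans ?_
    rw [Measure.restrict_apply (Finset.measurableSet_biUnion _ fun i _ => h.measurableSet i)]
    exact measure_mono Set.inter_subset_right
  · intro i hi
    obtain ⟨hiS, hti⟩ := Finset.mem_filter.1 hi
    have hQ := h.measurableSet i
    rw [Measure.smul_apply, smul_eq_mul, Measure.restrict_apply hQ, hτ,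
      withDensity_apply _ (hQ.inter hGm)]
    have h2 : 2 * (t * σ (Q i)) ≤ ∫⁻ x in Q i, ((2 * g x : ℝ≥0) : ℝ≥0∞) ∂σ := by
      calc 2 * (t * σ (Q i)) ≤ 2 * (A i * σ (Q i)) := by gcongr
        _ ≤ 2 * ∫⁻ x in Q i, g x ∂σ := by gcongr; exact hA i hiS
        _ = _ := by
          rw [← lintegral_const_mul _ hg.coe_nnreal_ennreal]
          simp
    have h3 : ∫⁻ x in Q i, ((2 * g x : ℝ≥0) : ℝ≥0∞) ∂σ
        ≤ ∫⁻ x in Q i ∩ G, ((2 * g x : ℝ≥0) : ℝ≥0∞) ∂σ + t * σ (Q i) := by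
      rw [← lintegral_inter_add_sdiff _ (Q i) hGm]
      gcongr
      calc ∫⁻ x in Q i \ G, ((2 * g x : ℝ≥0) : ℝ≥0∞) ∂σ ≤ ∫⁻ x in Q i \ G, (t : ℝ≥0∞) ∂σ := by
            refine setLIntegral_mono measurable_const fun x hx => ?_
            have : ¬ t < 2 * g x := hx.2
            exact_mod_cast not_lt.1 this
        _ = t * σ (Q i \ G) := by simp
        _ ≤ t * σ (Q i) := by gcongr; exact Set.sdiff_subset
    have h4 := h2.trans h3
    rw [two_mul] at h4
    exact (ENNReal.add_le_add_iff_right (ENNReal.mul_ne_top ENNReal.coe_ne_top (hσ i))).1 h4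

/-- Marcinkiewicz interpolation by two layer-cake formulas: the weak-type bound lowers the exponent
from p to p - 1 and replaces σ by the measure 2g σ, and the integral of (2g)^(p-1) against 2g σ is
again a p-th power integral. -/
theorem lintegral_maxFun_rpow_le (h : IsLaminar Q lev) (S : Finset ι) (A : ι → ℝ≥0)
    (σ : Measure X) (hσ : ∀ i, σ (Q i) ≠ ∞) {g : X → ℝ≥0} (hg : Measurable g)
    (hA : ∀ i ∈ S, A i * σ (Q i) ≤ ∫⁻ x in Q i, g x ∂σ) {p : ℝ} (hp : 1 < p) :
    ∫⁻ x, (maxFun Q S A x : ℝ≥0∞) ^ p ∂σ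
      ≤ ENNReal.ofReal (p / (p - 1)) * 2 ^ p * ∫⁻ x, (g x : ℝ≥0∞) ^ p ∂σ := by
  have hp0 : 0 < p := by linarith
  have hp1 : 0 < p - 1 := by linarith
  set τ := σ.withDensity fun x => ((2 * g x : ℝ≥0) : ℝ≥0∞) with hτ
  have conv : ∀ (f : X → ℝ≥0) (r : ℝ) (hr : 0 < r) (x : X),
      ENNReal.ofReal ((f x : ℝ) ^ r) = (f x : ℝ≥0∞) ^ r := by
    intro f r hr x
    rw [← ENNReal.ofReal_rpow_of_nonneg (by positivity) hr.le, ENNReal.ofReal_coe_nnreal]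
  have e1 := lintegral_rpow_eq_lintegral_meas_lt_mul σ (f := fun x => (maxFun Q S A x : ℝ))
    (Filter.Eventually.of_forall fun x => by positivity)
    (h.measurable_maxFun S A).coe_nnreal_real.aemeasurable hp0
  have e2 := lintegral_rpow_eq_lintegral_meas_lt_mul τ (f := fun x => ((2 * g x : ℝ≥0) : ℝ))
    (Filter.Eventually.of_forall fun x => by positivity)
    (hg.const_mul 2).coe_nnreal_real.aemeasurable hp1
  simp only [conv (maxFun Q S A) p hp0] at e1
  simp only [conv (fun x => 2 * g x) (p - 1) hp1] at e2
  have e3 : ∫⁻ x, ((2 * g x : ℝ≥0) : ℝ≥0∞) ^ (p - 1) ∂τ = 2 ^ p * ∫⁻ x, (g x : ℝ≥0∞) ^ p ∂σ := by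
    have hm : Measurable fun x => ((2 * g x : ℝ≥0) : ℝ≥0∞) :=
      (hg.const_mul 2).coe_nnreal_ennreal
    rw [hτ, lintegral_withDensity_eq_lintegral_mul _ hm (hm.pow_const _),
      ← lintegral_const_mul _ (hg.coe_nnreal_ennreal.pow_const _)]
    refine lintegral_congr fun x => ?_
    rw [Pi.mul_apply, ← ENNReal.mul_rpow_of_nonneg _ _ hp0.le, ENNReal.coe_mul]
    have : p = 1 + (p - 1) := by ring
    conv_rhs => rw [this, ENNReal.rpow_add_of_nonneg _ _ zero_le_one hp1.le, ENNReal.rpow_one]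
    norm_cast
  have e4 : ∫⁻ t in Set.Ioi (0 : ℝ), σ {x | t < maxFun Q S A x} * ENNReal.ofReal (t ^ (p - 1))
      ≤ ∫⁻ t in Set.Ioi (0 : ℝ), τ {x | t < ((2 * g x : ℝ≥0) : ℝ)}
        * ENNReal.ofReal (t ^ (p - 1 - 1)) := by
    refine setLIntegral_mono' measurableSet_Ioi fun t ht => ?_
    have ht0 : (0 : ℝ) < t := ht
    lift t to ℝ≥0 using ht0.le
    have e5 : ENNReal.ofReal ((t : ℝ) ^ (p - 1))
        = (t : ℝ≥0∞) * ENNReal.ofReal ((t : ℝ) ^ (p - 1 - 1)) := by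
      rw [← ENNReal.ofReal_coe_nnreal (p := t), ← ENNReal.ofReal_mul ht0.le,
        Real.rpow_sub_one ht0.ne' (p - 1), mul_div_cancel₀ _ ht0.ne']
    rw [e5, ← mul_assoc, mul_comm (σ _)]
    gcongr
    simpa only [NNReal.coe_lt_coe] using h.mul_measure_lt_maxFun_le S A σ hσ hg hA t
  rw [e1]
  have e6 : ENNReal.ofReal p = ENNReal.ofReal (p / (p - 1)) * ENNReal.ofReal (p - 1) := by
    rw [← ENNReal.ofReal_mul (by positivity)]
    congr 1
    field_simp
  rw [e6, mul_assoc, mul_assoc, ← e3, e2]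
  gcongr

/-- A form of the Carleson embedding theorem. -/
theorem sum_measure_mul_rpow_le (h : IsLaminar Q lev) (S : Finset ι) (A : ι → ℝ≥0)
    (σ : Measure X) (hσ : ∀ i, σ (Q i) ≠ ∞) {g : X → ℝ≥0} (hg : Measurable g)
    (hA : ∀ i ∈ S, A i * σ (Q i) ≤ ∫⁻ x in Q i, g x ∂σ) {p : ℝ} (hp : 1 < p) (C : ℝ≥0∞)
    (hC : ∀ i ∈ S, σ (Q i) ≤ C * σ (core Q lev S i)) :
    ∑ i ∈ S, σ (Q i) * (A i : ℝ≥0∞) ^ p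
      ≤ C * (ENNReal.ofReal (p / (p - 1)) * 2 ^ p) * ∫⁻ x, (g x : ℝ≥0∞) ^ p ∂σ := by
  rw [mul_assoc]
  -- Passing from Q i to its core costs C; the cores are disjoint and the maximal function is at
  -- least A i there.
  calc ∑ i ∈ S, σ (Q i) * (A i : ℝ≥0∞) ^ p
      ≤ ∑ i ∈ S, C * ∫⁻ x in core Q lev S i, (maxFun Q S A x : ℝ≥0∞) ^ p ∂σ := by
        refine Finset.sum_le_sum fun i hi => ?_
        calc σ (Q i) * (A i : ℝ≥0∞) ^ p ≤ C * σ (core Q lev S i) * (A i : ℝ≥0∞) ^ p := by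
              gcongr; exact hC i hi
          _ = C * ∫⁻ x in core Q lev S i, (A i : ℝ≥0∞) ^ p ∂σ := by
              rw [setLIntegral_const, mul_assoc, mul_comm (σ _)]
          _ ≤ _ := by
              gcongr C * ?_
              refine setLIntegral_mono' (h.measurableSet_core S i) fun x hx => ?_
              gcongr
              exact le_maxFun hi (core_subset S i hx)
    _ = C * ∫⁻ x in ⋃ i ∈ S, core Q lev S i, (maxFun Q S A x : ℝ≥0∞) ^ p ∂σ := by
        rw [← Finset.mul_sum, lintegral_biUnion_finset (h.disjoint_core S)
          fun i _ => h.measurableSet_core S i]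
    _ ≤ C * ∫⁻ x, (maxFun Q S A x : ℝ≥0∞) ^ p ∂σ := by
        gcongr
        exact Measure.restrict_le_self
    _ ≤ _ := by
        gcongr
        exact h.lintegral_maxFun_rpow_le S A σ hσ hg hA hp

end IsLaminar

/-- Each term is at most the ℓ^r norm B, hence b^s ≤ b^r B^(s-r). -/
theorem ENNReal.sum_rpow_rpow_one_div_le {ι : Type*} (S : Finset ι) (b : ι → ℝ≥0∞) {r s : ℝ}
    (hr : 0 < r) (hrs : r ≤ s) :
    (∑ i ∈ S, b i ^ s) ^ (1 / s) ≤ (∑ i ∈ S, b i ^ r) ^ (1 / r) := by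
  have hs : 0 < s := hr.trans_le hrs
  set B := (∑ i ∈ S, b i ^ r) ^ (1 / r) with hB
  have hBr : B ^ r = ∑ i ∈ S, b i ^ r := by
    rw [hB, ← ENNReal.rpow_mul, one_div_mul_cancel hr.ne', ENNReal.rpow_one]
  have hb : ∀ i ∈ S, b i ≤ B := by
    intro i hi
    rw [← ENNReal.rpow_le_rpow_iff hr, hBr]
    exact Finset.single_le_sum (f := fun i => b i ^ r) (fun _ _ => zero_le) hi
  rw [one_div, ENNReal.rpow_inv_le_iff hs]
  have hs' : s = r + (s - r) := by ring
  calc ∑ i ∈ S, b i ^ s ≤ ∑ i ∈ S, b i ^ r * B ^ (s - r) := by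
        refine Finset.sum_le_sum fun i hi => ?_
        conv_lhs => rw [hs', ENNReal.rpow_add_of_nonneg _ _ hr.le (by linarith)]
        exact mul_le_mul_right (ENNReal.rpow_le_rpow (hb i hi) (by linarith)) _
    _ = B ^ s := by
        rw [← Finset.sum_mul, ← hBr]
        conv_rhs => rw [hs', ENNReal.rpow_add_of_nonneg _ _ hr.le (by linarith)]

/-! ### The dyadic two-weight inequality -/

namespace IsLaminar

variable {X ι : Type*} [MeasurableSpace X] {Q : ι → Set X} {lev : ι → ℤ}

/-- The data of the two-weight problem on a laminar family: the reference measure `μ` gives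
sets of level `n` measure `2 ^ (d n)`, `σ` and `ω` satisfy a joint bump-free `A_{p,q}` condition
with constant `K` and each of them is quantitatively absolutely continuous with respect to `μ`. -/
structure TwoWeight (Q : ι → Set X) (lev : ι → ℤ) (μ σ ω : Measure X) (d α p q : ℝ)
    (K Cσ Cω : ℝ≥0∞) : Prop where
  laminar : IsLaminar Q lev
  measure_eq : ∀ i, μ (Q i) = 2 ^ (d * lev i)
  left_ne_zero : ∀ i, σ (Q i) ≠ 0
  left_ne_top : ∀ i, σ (Q i) ≠ ∞
  right_ne_zero : ∀ i, ω (Q i) ≠ 0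
  right_ne_top : ∀ i, ω (Q i) ≠ ∞
  apq : ∀ i, 2 ^ ((α - d) * lev i) * σ (Q i) ^ (1 / p.conjExponent) * ω (Q i) ^ (1 / q) ≤ K
  left_le : ∀ i E, MeasurableSet E → E ⊆ Q i → μ (Q i) ≤ 2 * μ E → σ (Q i) ≤ Cσ * σ E
  right_le : ∀ i E, MeasurableSet E → E ⊆ Q i → μ (Q i) ≤ 2 * μ E → ω (Q i) ≤ Cω * ω E

/-- The constant in the dyadic two-weight inequality. -/
noncomputable def twoWeightConst (α p q : ℝ) (K Cσ Cω : ℝ≥0∞) : ℝ≥0∞ :=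
  2 * (1 - 2 ^ (-α))⁻¹ * K *
    ((Cσ * (ENNReal.ofReal (p / (p - 1)) * 2 ^ p)) ^ (1 / p) *
      (Cω * (ENNReal.ofReal (q.conjExponent / (q.conjExponent - 1)) * 2 ^ q.conjExponent))
        ^ (1 / q.conjExponent))

theorem twoWeightConst_ne_top {α p q : ℝ} {K Cσ Cω : ℝ≥0∞} (hα : 0 < α) (hp : 1 < p) (hq : 1 < q)
    (hK : K ≠ ∞) (hσ : Cσ ≠ ∞) (hω : Cω ≠ ∞) : twoWeightConst α p q K Cσ Cω ≠ ∞ := by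
  have hq' := (Real.HolderConjugate.conjExponent hq).symm.pos
  have hlt : (2 : ℝ≥0∞) ^ (-α) < 1 := ENNReal.rpow_lt_one_of_one_lt_of_neg (by norm_num) (by linarith)
  have h1 : (1 - (2 : ℝ≥0∞) ^ (-α))⁻¹ ≠ ∞ := ENNReal.inv_ne_top.2 (tsub_pos_of_lt hlt).ne'
  have h2 : ∀ r : ℝ, 0 < r → (2 : ℝ≥0∞) ^ r ≠ ∞ := fun r hr =>
    ENNReal.rpow_ne_top_of_nonneg hr.le (by simp)
  refine ENNReal.mul_ne_top (ENNReal.mul_ne_top (ENNReal.mul_ne_top (by simp) h1) hK)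
    (ENNReal.mul_ne_top (ENNReal.rpow_ne_top_of_nonneg (by positivity) ?_)
      (ENNReal.rpow_ne_top_of_nonneg (by positivity) ?_))
  · exact ENNReal.mul_ne_top hσ (ENNReal.mul_ne_top (by simp) (h2 _ (by linarith)))
  · exact ENNReal.mul_ne_top hω (ENNReal.mul_ne_top (by simp) (h2 _ hq'))

variable {μ σ ω : Measure X} {d α p q : ℝ} {K Cσ Cω : ℝ≥0∞}

/-- Each set is charged to a principal set that dominates it; what is charged to one principal set
is a geometric sum. -/
theorem sum_principal_le (h : IsLaminar Q lev) (F : Finset ι) (H : Measure X) {α : ℝ}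
    (a : ι → ℝ≥0∞) (S : Finset ι)
    (hS : ∀ i ∈ F, ∃ j ∈ S, lev i ≤ lev j ∧ Q i ⊆ Q j ∧ a i ≤ 2 * a j) :
    ∑ i ∈ F, 2 ^ (α * lev i) * a i * H (Q i)
      ≤ 2 * (1 - 2 ^ (-α))⁻¹ * ∑ j ∈ S, 2 ^ (α * lev j) * a j * H (Q j) := by
  classical
  calc ∑ i ∈ F, 2 ^ (α * lev i) * a i * H (Q i)
      ≤ ∑ i ∈ F, ∑ j ∈ S, if lev i ≤ lev j ∧ Q i ⊆ Q j then
          2 * a j * (2 ^ (α * lev i) * H (Q i)) else 0 := by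
        refine Finset.sum_le_sum fun i hi => ?_
        obtain ⟨j, hj, h1, h2, h3⟩ := hS i hi
        refine le_trans ?_ (Finset.single_le_sum (fun _ _ => zero_le) hj)
        rw [if_pos ⟨h1, h2⟩]
        calc 2 ^ (α * lev i) * a i * H (Q i) ≤ 2 ^ (α * lev i) * (2 * a j) * H (Q i) := by gcongr
          _ = _ := by ring
    _ = ∑ j ∈ S, 2 * a j * ∑ i ∈ F with lev i ≤ lev j ∧ Q i ⊆ Q j,
          2 ^ (α * lev i) * H (Q i) := by
        rw [Finset.sum_comm]
        refine Finset.sum_congr rfl fun j _ => ?_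
        rw [← Finset.sum_filter, Finset.mul_sum]
    _ ≤ ∑ j ∈ S, 2 * a j * ((1 - 2 ^ (-α))⁻¹ * (2 ^ (α * lev j) * H (Q j))) := by
        refine Finset.sum_le_sum fun j _ => ?_
        gcongr
        exact h.sum_lev_rpow_mul_le _ H j fun i hi => (Finset.mem_filter.1 hi).2
    _ = _ := by
        rw [Finset.mul_sum]
        refine Finset.sum_congr rfl fun j _ => ?_
        ring

/-- The heart of the proof, in dual form. Stopping is governed by the μ-averages of gσ, while the
final estimate uses the σ-averages of g and the ω-averages of k; `left_le` and `right_le` link the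
two. -/
theorem TwoWeight.sum_mul_le (T : TwoWeight Q lev μ σ ω d α p q K Cσ Cω)
    (hp : 1 < p) (hpq : p ≤ q) (F : Finset ι) {g k : X → ℝ≥0} (hg : Measurable g)
    (hk : Measurable k) (hgQ : ∀ i, ∫⁻ x in Q i, g x ∂σ ≠ ∞) (hkQ : ∀ i, ∫⁻ x in Q i, k x ∂ω ≠ ∞) :
    ∑ i ∈ F, 2 ^ ((α - d) * lev i) * (∫⁻ x in Q i, g x ∂σ) * ∫⁻ x in Q i, k x ∂ω
      ≤ twoWeightConst α p q K Cσ Cω * ((∫⁻ x, (g x : ℝ≥0∞) ^ p ∂σ) ^ (1 / p) *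
        (∫⁻ x, (k x : ℝ≥0∞) ^ q.conjExponent ∂ω) ^ (1 / q.conjExponent)) := by
  classical
  have hL := T.laminar
  have hq : 1 < q := hp.trans_le hpq
  have hpp := Real.HolderConjugate.conjExponent hp
  have hqq := Real.HolderConjugate.conjExponent hq
  have hq'p' : q.conjExponent ≤ p.conjExponent := by
    have h1 := hpp.inv_add_inv_eq_one
    have h2 := hqq.inv_add_inv_eq_one
    have h3 : q⁻¹ ≤ p⁻¹ := inv_anti₀ hpp.pos hpq
    exact (inv_le_inv₀ hpp.symm.pos hqq.symm.pos).1 (by linarith)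
  set ν := σ.withDensity fun x => (g x : ℝ≥0∞) with hνdef
  set H := ω.withDensity fun x => (k x : ℝ≥0∞) with hHdef
  have hν : ∀ i, ∫⁻ x in Q i, g x ∂σ = ν (Q i) := fun i =>
    (withDensity_apply _ (hL.measurableSet i)).symm
  have hH : ∀ i, ∫⁻ x in Q i, k x ∂ω = H (Q i) := fun i =>
    (withDensity_apply _ (hL.measurableSet i)).symm
  simp only [hν] at hgQ
  simp only [hH] at hkQ
  simp only [hν, hH]
  have hμ0 : ∀ i, μ (Q i) ≠ 0 := fun i => by
    rw [T.measure_eq]; exact (ENNReal.rpow_pos (by simp) (by simp)).ne'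
  have hμt : ∀ i, μ (Q i) ≠ ∞ := fun i => by
    rw [T.measure_eq]; exact ENNReal.rpow_ne_top_of_ne_zero (by simp) (by simp)
  set a : ι → ℝ≥0∞ := fun i => ν (Q i) / μ (Q i) with ha
  -- Sets with ν(Q i) = 0 contribute nothing, and the sparseness argument divides by the average, so
  -- they are dropped.
  obtain ⟨S, hSF, hS1, hS2⟩ := exists_principal Q lev (F.filter fun i => ν (Q i) ≠ 0) a
  have hS0 : ∀ i ∈ S, ν (Q i) ≠ 0 := fun i hi => (Finset.mem_filter.1 (hSF hi)).2
  have hsparse := hL.measure_le_two_mul_core S μ ν hμ0 hμt hgQ hS0 hS2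
  have hterm : ∀ i, 2 ^ ((α - d) * lev i) * ν (Q i) * H (Q i)
      = 2 ^ (α * lev i) * a i * H (Q i) := by
    intro i
    rw [ha, sub_mul, ENNReal.rpow_sub _ _ (by simp) (by simp), ← T.measure_eq]
    simp only [div_eq_mul_inv]
    ring
  set A : ι → ℝ≥0 := fun i => (ν (Q i) / σ (Q i)).toNNReal with hAdef
  set B : ι → ℝ≥0 := fun i => (H (Q i) / ω (Q i)).toNNReal with hBdef
  have hA : ∀ i, A i * σ (Q i) = ν (Q i) := fun i => by
    rw [hAdef, ENNReal.coe_toNNReal (ENNReal.div_ne_top (hgQ i) (T.left_ne_zero i)),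
      ENNReal.div_mul_cancel (T.left_ne_zero i) (T.left_ne_top i)]
  have hB : ∀ i, B i * ω (Q i) = H (Q i) := fun i => by
    rw [hBdef, ENNReal.coe_toNNReal (ENNReal.div_ne_top (hkQ i) (T.right_ne_zero i)),
      ENNReal.div_mul_cancel (T.right_ne_zero i) (T.right_ne_top i)]
  have hA' : ∀ i ∈ S, A i * σ (Q i) ≤ ∫⁻ x in Q i, g x ∂σ := fun i _ => by rw [hA, hν]
  have hB' : ∀ i ∈ S, B i * ω (Q i) ≤ ∫⁻ x in Q i, k x ∂ω := fun i _ => by rw [hB, hH]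
  have carlA := hL.sum_measure_mul_rpow_le S A σ T.left_ne_top hg hA' hp Cσ fun i hi =>
    T.left_le i _ (hL.measurableSet_core S i) (core_subset S i) (hsparse i hi)
  have carlB := hL.sum_measure_mul_rpow_le S B ω T.right_ne_top hk hB' hqq.symm.lt Cω fun i hi =>
    T.right_le i _ (hL.measurableSet_core S i) (core_subset S i) (hsparse i hi)
  have hpow : ∀ (m c : ℝ≥0∞) (r : ℝ), 0 < r → (m ^ (1 / r) * c) ^ r = m * c ^ r := by
    intro m c r hr
    rw [ENNReal.mul_rpow_of_nonneg _ _ hr.le, ← ENNReal.rpow_mul, one_div_mul_cancel hr.ne',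
      ENNReal.rpow_one]
  calc ∑ i ∈ F, 2 ^ ((α - d) * lev i) * ν (Q i) * H (Q i)
      = ∑ i ∈ F with ν (Q i) ≠ 0, 2 ^ (α * lev i) * a i * H (Q i) := by
        rw [Finset.sum_filter_of_ne (p := fun i => ν (Q i) ≠ 0) fun i _ hne h0 => hne (by simp [ha, h0])]
        exact Finset.sum_congr rfl fun i _ => hterm i
    _ ≤ 2 * (1 - 2 ^ (-α))⁻¹ * ∑ j ∈ S, 2 ^ (α * lev j) * a j * H (Q j) :=
        hL.sum_principal_le _ H a S hS1
    _ ≤ 2 * (1 - 2 ^ (-α))⁻¹ * (K * ∑ j ∈ S, (σ (Q j) ^ (1 / p) * A j) *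
          (ω (Q j) ^ (1 / q.conjExponent) * B j)) := by
        rw [Finset.mul_sum S _ K]
        refine mul_le_mul_right (Finset.sum_le_sum fun j hj => ?_) _
        rw [← hterm, ← hA, ← hB]
        -- The powers 1/p' of σ and 1/q of ω go into the A_{p,q} constant; the complementary powers
        -- are those that Carleson embedding needs.
        have e1 : σ (Q j) = σ (Q j) ^ (1 / p.conjExponent) * σ (Q j) ^ (1 / p) := by
          rw [← ENNReal.rpow_add_of_nonneg _ _ (by have := hpp.symm.pos; positivity)
            (by have := hpp.pos; positivity), one_div, one_div, add_comm,
            hpp.inv_add_inv_eq_one, ENNReal.rpow_one]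
        have e2 : ω (Q j) = ω (Q j) ^ (1 / q) * ω (Q j) ^ (1 / q.conjExponent) := by
          rw [← ENNReal.rpow_add_of_nonneg _ _ (by have := hqq.pos; positivity)
            (by have := hqq.symm.pos; positivity), one_div, one_div,
            hqq.inv_add_inv_eq_one, ENNReal.rpow_one]
        calc 2 ^ ((α - d) * lev j) * (A j * σ (Q j)) * (B j * ω (Q j))
            = (2 ^ ((α - d) * lev j) * σ (Q j) ^ (1 / p.conjExponent) * ω (Q j) ^ (1 / q)) *
              ((σ (Q j) ^ (1 / p) * A j) * (ω (Q j) ^ (1 / q.conjExponent) * B j)) := by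
              conv_lhs => rw [e1, e2]
              ring
          _ ≤ _ := by
              gcongr
              exact T.apq j
    _ ≤ 2 * (1 - 2 ^ (-α))⁻¹ * (K * ((∑ j ∈ S, σ (Q j) * (A j : ℝ≥0∞) ^ p) ^ (1 / p) *
          (∑ j ∈ S, ω (Q j) * (B j : ℝ≥0∞) ^ q.conjExponent) ^ (1 / q.conjExponent))) := by
        gcongr
        refine (ENNReal.inner_le_Lp_mul_Lq S _ _ hpp).trans ?_
        simp only [← hpow _ _ _ hpp.pos, ← hpow _ _ _ hqq.symm.pos]
        gcongr
        exact ENNReal.sum_rpow_rpow_one_div_le S _ hqq.symm.pos hq'p'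
    _ ≤ _ := by
        have hp0 := hpp.pos
        have hq0 := hqq.symm.pos
        refine (mul_le_mul_right (mul_le_mul_right (mul_le_mul'
          (ENNReal.rpow_le_rpow carlA (by positivity))
          (ENNReal.rpow_le_rpow carlB (by positivity))) K) _).trans (le_of_eq ?_)
        rw [ENNReal.mul_rpow_of_nonneg _ _ (by positivity),
          ENNReal.mul_rpow_of_nonneg _ (∫⁻ x, (k x : ℝ≥0∞) ^ q.conjExponent ∂ω) (by positivity),
          twoWeightConst]
        ring

/-- Duality with the explicit extremal k = G^(q-1), where G is the dyadic operator applied to g: the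
form then equals I = ∫ G^q dω, and k^(q') = G^q. -/
theorem TwoWeight.lintegral_sum_rpow_le (T : TwoWeight Q lev μ σ ω d α p q K Cσ Cω)
    (hp : 1 < p) (hpq : p ≤ q) (F : Finset ι) {g : X → ℝ≥0} (hg : Measurable g)
    (hgQ : ∀ i, ∫⁻ x in Q i, g x ∂σ ≠ ∞) :
    ∫⁻ x, (∑ i ∈ F, (Q i).indicator
        (fun _ => 2 ^ ((α - d) * lev i) * ∫⁻ x in Q i, g x ∂σ) x) ^ q ∂ω
      ≤ (twoWeightConst α p q K Cσ Cω * (∫⁻ x, (g x : ℝ≥0∞) ^ p ∂σ) ^ (1 / p)) ^ q := by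
  classical
  have hL := T.laminar
  have hq : 1 < q := hp.trans_le hpq
  have hqq := Real.HolderConjugate.conjExponent hq
  have hq1 : 0 < q - 1 := by linarith
  set c : ι → ℝ≥0∞ := fun i => 2 ^ ((α - d) * lev i) * ∫⁻ x in Q i, g x ∂σ with hc
  have hct : ∀ i, c i ≠ ∞ := fun i =>
    ENNReal.mul_ne_top (ENNReal.rpow_ne_top_of_ne_zero (by simp) (by simp)) (hgQ i)
  set G : X → ℝ≥0 := fun x => ∑ i ∈ F, (Q i).indicator (fun _ => (c i).toNNReal) x with hGdef
  have hGm : Measurable G :=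
    Finset.measurable_fun_sum _ fun i _ => measurable_const.indicator (hL.measurableSet i)
  have hG : ∀ x, ∑ i ∈ F, (Q i).indicator (fun _ => c i) x = G x := by
    intro x
    rw [hGdef, ENNReal.ofNNReal_finsetSum]
    refine Finset.sum_congr rfl fun i _ => ?_
    by_cases hx : x ∈ Q i <;> simp [hx, ENNReal.coe_toNNReal (hct i)]
  have hG' : ∀ x, ∑ i ∈ F, (Q i).indicator
      (fun _ => 2 ^ ((α - d) * lev i) * ∫⁻ x in Q i, g x ∂σ) x = G x := hG
  simp only [hG']
  set k : X → ℝ≥0 := fun x => G x ^ (q - 1) with hkdef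
  have hkm : Measurable k := hGm.pow_const _
  have hkQ : ∀ i, ∫⁻ x in Q i, k x ∂ω ≠ ∞ := by
    intro i
    refine ne_top_of_le_ne_top (b := ∫⁻ x in Q i,
      (((∑ i ∈ F, (c i).toNNReal) ^ (q - 1) : ℝ≥0) : ℝ≥0∞) ∂ω) ?_ ?_
    · rw [setLIntegral_const]
      exact ENNReal.mul_ne_top ENNReal.coe_ne_top (T.right_ne_top i)
    · refine lintegral_mono fun x => ?_
      simp only [ENNReal.coe_le_coe]
      refine NNReal.rpow_le_rpow (Finset.sum_le_sum fun i _ => ?_) hq1.le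
      exact Set.indicator_le_self' (fun _ _ => zero_le) x
  have hI : ∫⁻ x, (G x : ℝ≥0∞) ^ q ∂ω = ∑ i ∈ F, c i * ∫⁻ x in Q i, k x ∂ω := by
    have : ∀ x, (G x : ℝ≥0∞) ^ q = ∑ i ∈ F, c i * (Q i).indicator (fun x => (k x : ℝ≥0∞)) x := by
      intro x
      have e : q = 1 + (q - 1) := by ring
      conv_lhs => rw [e, ENNReal.rpow_add_of_nonneg _ _ zero_le_one hq1.le, ENNReal.rpow_one]
      conv_lhs => arg 1; rw [← hG x]
      rw [Finset.sum_mul]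
      refine Finset.sum_congr rfl fun i _ => ?_
      by_cases hx : x ∈ Q i <;> simp [hx, hkdef, ENNReal.coe_rpow_of_nonneg _ hq1.le]
    simp only [this]
    rw [lintegral_finsetSum _ fun i _ =>
      (hkm.coe_nnreal_ennreal.indicator (hL.measurableSet i)).const_mul _]
    refine Finset.sum_congr rfl fun i _ => ?_
    rw [lintegral_const_mul _ (hkm.coe_nnreal_ennreal.indicator (hL.measurableSet i)),
      lintegral_indicator (hL.measurableSet i)]
  -- Finiteness, which comes from `F` being finite, allows I^(1/q') to be cancelled below.
  have hIt : ∫⁻ x, (G x : ℝ≥0∞) ^ q ∂ω ≠ ∞ := by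
    rw [hI]
    exact ENNReal.sum_ne_top.2 fun i _ => ENNReal.mul_ne_top (hct i) (hkQ i)
  have hmain := T.sum_mul_le hp hpq F hg hkm hgQ hkQ
  have hkq : ∀ x, (k x : ℝ≥0∞) ^ q.conjExponent = (G x : ℝ≥0∞) ^ q := by
    intro x
    rw [show k x = G x ^ (q - 1) from rfl, ENNReal.coe_rpow_of_nonneg _ hq1.le, ← ENNReal.rpow_mul, Real.conjExponent,
      mul_div_cancel₀ _ hq1.ne']
  rw [← hI] at hmain
  simp only [hkq] at hmain
  set I := ∫⁻ x, (G x : ℝ≥0∞) ^ q ∂ω with hIdef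
  rw [← mul_assoc] at hmain
  rcases eq_or_ne I 0 with h0 | h0
  · rw [h0]; exact zero_le
  have hsplit : I = I ^ (1 / q) * I ^ (1 / q.conjExponent) := by
    rw [← ENNReal.rpow_add _ _ h0 hIt, one_div, one_div, hqq.inv_add_inv_eq_one, ENNReal.rpow_one]
  have hle : I ^ (1 / q) ≤ twoWeightConst α p q K Cσ Cω
      * (∫⁻ x, (g x : ℝ≥0∞) ^ p ∂σ) ^ (1 / p) := by
    refine (ENNReal.mul_le_mul_iff_left ?_ ?_).1 (hsplit.symm.le.trans hmain)
    · exact (ENNReal.rpow_pos (pos_iff_ne_zero.2 h0) hIt).ne'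
    · exact ENNReal.rpow_ne_top_of_ne_zero h0 hIt
  rwa [one_div, ENNReal.rpow_inv_le_iff hqq.pos] at hle

theorem TwoWeight.lintegral_tsum_rpow_le [Countable ι] (T : TwoWeight Q lev μ σ ω d α p q K Cσ Cω)
    (hp : 1 < p) (hpq : p ≤ q) {g : X → ℝ≥0} (hg : Measurable g)
    (hgQ : ∀ i, ∫⁻ x in Q i, g x ∂σ ≠ ∞) :
    ∫⁻ x, (∑' i, (Q i).indicator
        (fun _ => 2 ^ ((α - d) * lev i) * ∫⁻ x in Q i, g x ∂σ) x) ^ q ∂ω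
      ≤ (twoWeightConst α p q K Cσ Cω * (∫⁻ x, (g x : ℝ≥0∞) ^ p ∂σ) ^ (1 / p)) ^ q := by
  have hq0 : 0 < q := by linarith
  have hsup : ∀ u : ι → ℝ≥0∞, (∑' i, u i) ^ q = ⨆ F : Finset ι, (∑ i ∈ F, u i) ^ q := by
    intro u
    rw [ENNReal.tsum_eq_iSup_sum]
    exact (ENNReal.orderIsoRpow q hq0).map_iSup _
  simp only [hsup]
  rw [lintegral_iSup_directed]
  · exact iSup_le fun F => T.lintegral_sum_rpow_le hp hpq F hg hgQ
  · intro F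
    exact ((Finset.measurable_fun_sum _ fun i _ =>
      measurable_const.indicator (T.laminar.measurableSet i)).pow_const _).aemeasurable
  · refine Monotone.directed_le fun F F' hF x => ?_
    exact ENNReal.rpow_le_rpow (Finset.sum_le_sum_of_subset hF) hq0.le

end IsLaminar

/-! ### Cubes and weights -/

section Cubes

variable {d : ℕ}

theorem cube_eq_preimage (x : EuclideanSpace ℝ (Fin d)) (l : ℝ) :
    cube x l = (MeasurableEquiv.toLp 2 (Fin d → ℝ)).symm ⁻¹'
      Set.univ.pi fun i => Set.Ico (x i) (x i + l) := by
  ext y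
  simp [cube]

theorem measurableSet_cube (x : EuclideanSpace ℝ (Fin d)) (l : ℝ) : MeasurableSet (cube x l) := by
  rw [cube_eq_preimage]
  exact (MeasurableEquiv.measurable _) (MeasurableSet.univ_pi fun _ => measurableSet_Ico)

theorem volume_cube (x : EuclideanSpace ℝ (Fin d)) (l : ℝ) :
    volume (cube x l) = ENNReal.ofReal l ^ d := by
  rw [cube_eq_preimage, (EuclideanSpace.volume_preserving_symm_measurableEquiv_toLp
    (Fin d)).measure_preimage_equiv, Real.volume_pi_Ico]
  simp

theorem volume_cube_ne_zero (x : EuclideanSpace ℝ (Fin d)) {l : ℝ} (hl : 0 < l) :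
    volume (cube x l) ≠ 0 := by
  rw [volume_cube]
  exact pow_ne_zero _ (ENNReal.ofReal_pos.2 hl).ne'

theorem volume_cube_ne_top (x : EuclideanSpace ℝ (Fin d)) (l : ℝ) :
    volume (cube x l) ≠ ∞ := by
  rw [volume_cube]
  exact ENNReal.pow_ne_top ENNReal.ofReal_ne_top

theorem norm_sub_le_of_mem_cube {x y : EuclideanSpace ℝ (Fin d)} {l : ℝ} (hy : y ∈ cube x l) :
    ‖y - x‖ ≤ √d * l := by
  rcases Nat.eq_zero_or_pos d with rfl | hd
  · simp [EuclideanSpace.norm_eq]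
  have hl : 0 ≤ l := by
    have := hy ⟨0, hd⟩
    linarith
  rw [EuclideanSpace.norm_eq]
  refine (Real.sqrt_le_sqrt (y := d * l ^ 2) ?_).trans ?_
  · calc ∑ i, ‖(y - x) i‖ ^ 2 ≤ ∑ _i : Fin d, l ^ 2 := by
          refine Finset.sum_le_sum fun i _ => ?_
          have := hy i
          rw [PiLp.sub_apply, Real.norm_eq_abs, abs_of_nonneg (by linarith)]
          exact pow_le_pow_left₀ (by linarith) (by linarith) 2
      _ = d * l ^ 2 := by simp
  · rw [Real.sqrt_mul (by positivity), Real.sqrt_sq hl]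

theorem cube_subset_closedBall (x : EuclideanSpace ℝ (Fin d)) (l : ℝ) :
    cube x l ⊆ Metric.closedBall x (√d * l) := fun y hy => by
  rw [Metric.mem_closedBall, dist_eq_norm]
  exact norm_sub_le_of_mem_cube hy

theorem MeasureTheory.LocallyIntegrable.integrableOn_cube
    {w : EuclideanSpace ℝ (Fin d) → ℝ} (hw : LocallyIntegrable w volume)
    (x : EuclideanSpace ℝ (Fin d)) (l : ℝ) : IntegrableOn w (cube x l) volume :=
  (hw.integrableOn_isCompact (isCompact_closedBall x _)).mono_set (cube_subset_closedBall x l)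

theorem weightMeasure_apply {w : EuclideanSpace ℝ (Fin d) → ℝ}
    {E : Set (EuclideanSpace ℝ (Fin d))} (hE : MeasurableSet E) :
    weightMeasure w E = ∫⁻ y in E, ENNReal.ofReal (w y) :=
  withDensity_apply _ hE

theorem IsWeight.aemeasurable {w : EuclideanSpace ℝ (Fin d) → ℝ} (hw : IsWeight w) :
    AEMeasurable w volume := hw.1.aestronglyMeasurable.aemeasurable

theorem IsWeight.volume_absolutelyContinuous {w : EuclideanSpace ℝ (Fin d) → ℝ}
    (hw : IsWeight w) : volume ≪ weightMeasure w := by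
  refine withDensity_absolutelyContinuous' hw.aemeasurable.ennreal_ofReal ?_
  filter_upwards [hw.2] with x hx
  exact (ENNReal.ofReal_pos.2 hx).ne'

theorem weightMeasure_absolutelyContinuous (w : EuclideanSpace ℝ (Fin d) → ℝ) :
    weightMeasure w ≪ volume := withDensity_absolutelyContinuous _ _

theorem IsWeight.weightMeasure_eq_ofReal {w : EuclideanSpace ℝ (Fin d) → ℝ} (hw : IsWeight w)
    {x : EuclideanSpace ℝ (Fin d)} {l : ℝ} {E : Set (EuclideanSpace ℝ (Fin d))}
    (hE : MeasurableSet E) (hEQ : E ⊆ cube x l) :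
    weightMeasure w E = ENNReal.ofReal (∫ y in E, w y) := by
  rw [weightMeasure_apply hE, ofReal_integral_eq_lintegral_ofReal]
  · exact (hw.1.integrableOn_cube x l).mono_set hEQ
  · exact ae_restrict_of_ae (hw.2.mono fun y hy => hy.le)

theorem IsWeight.weightMeasure_cube_ne_top {w : EuclideanSpace ℝ (Fin d) → ℝ} (hw : IsWeight w)
    (x : EuclideanSpace ℝ (Fin d)) (l : ℝ) : weightMeasure w (cube x l) ≠ ∞ := by
  rw [hw.weightMeasure_eq_ofReal (measurableSet_cube x l) subset_rfl]
  exact ENNReal.ofReal_ne_top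

theorem IsWeight.weightMeasure_cube_ne_zero {w : EuclideanSpace ℝ (Fin d) → ℝ} (hw : IsWeight w)
    (x : EuclideanSpace ℝ (Fin d)) {l : ℝ} (hl : 0 < l) : weightMeasure w (cube x l) ≠ 0 :=
  fun h => volume_cube_ne_zero x hl (hw.volume_absolutelyContinuous h)

/-- Integrated form of the tangent inequality `log w ≤ w / a - 1 + log a`. -/
theorem setIntegral_log_le {X : Type*} [MeasurableSpace X] {μ : Measure X} {E : Set X}
    {w : X → ℝ} (hμE : μ E ≠ ∞) (hw : IntegrableOn w E μ) (hw0 : ∀ᵐ x ∂μ, 0 < w x)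
    (hlog : IntegrableOn (fun x => Real.log (w x)) E μ) {a : ℝ} (ha : 0 < a) :
    ∫ x in E, Real.log (w x) ∂μ ≤ (∫ x in E, w x ∂μ) / a + μ.real E * (Real.log a - 1) := by
  have hc : IntegrableOn (fun _ : X => Real.log a - 1) E μ := integrableOn_const hμE
  calc ∫ x in E, Real.log (w x) ∂μ ≤ ∫ x in E, (w x / a + (Real.log a - 1)) ∂μ := by
        refine integral_mono_ae hlog ((hw.div_const a).add hc) ?_
        refine ae_restrict_of_ae (hw0.mono fun x hx => ?_)
        have := Real.log_le_sub_one_of_pos (div_pos hx ha)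
        rw [Real.log_div hx.ne' ha.ne'] at this
        simp only
        linarith
    _ = _ := by
        rw [integral_add (hw.div_const a) hc, integral_div, setIntegral_const, smul_eq_mul]

/-- By A_∞, the mean of log w on the cube is at least the log of the mean, up to a constant. If w
had little mass on a set E of at least half the volume, log w would have a very negative integral on
E, and by concavity the complement cannot compensate. -/
theorem IsAInfty.exists_measure_le {w : EuclideanSpace ℝ (Fin d) → ℝ} (hw : IsAInfty w) :
    ∃ M : ℝ≥0, ∀ (x : EuclideanSpace ℝ (Fin d)) (l : ℝ), 0 < l →
      ∀ E, MeasurableSet E → E ⊆ cube x l → volume (cube x l) ≤ 2 * volume E →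
        weightMeasure w (cube x l) ≤ M * weightMeasure w E := by
  obtain ⟨hW, C, hC⟩ := hw
  -- Makes log C' nonnegative, so that m ≤ 2t may be multiplied by it.
  set C' := max C 1 with hC'
  have hC1 : 1 ≤ C' := le_max_right _ _
  set R := Real.exp (2 * (Real.log C' + 1)) with hR
  refine ⟨(2 * R).toNNReal, fun x l hl E hE hEQ hvol => ?_⟩
  obtain ⟨hlog, hA⟩ := hC x l hl
  set D := cube x l with hD
  have hDm : MeasurableSet D := measurableSet_cube x l
  have hDt : volume D ≠ ∞ := volume_cube_ne_top x l
  have hEt : volume E ≠ ∞ := ne_top_of_le_ne_top hDt (measure_mono hEQ)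
  set m := volume.real D with hm
  set t := volume.real E with ht
  have hm0 : 0 < m := ENNReal.toReal_pos (volume_cube_ne_zero x hl) hDt
  have htm : m ≤ 2 * t := by
    have := ENNReal.toReal_mono (ENNReal.mul_ne_top (by simp) hEt) hvol
    rwa [ENNReal.toReal_mul] at this
  have ht0 : 0 < t := by linarith
  have hwD : IntegrableOn w D volume := hW.1.integrableOn_cube x l
  have hposint : ∀ A ⊆ D, volume A ≠ 0 → MeasurableSet A → 0 < ∫ y in A, w y := by
    intro A hAD hA0 hAm
    have h1 := hW.weightMeasure_eq_ofReal hAm hAD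
    have h2 : weightMeasure w A ≠ 0 := fun h => hA0 (hW.volume_absolutelyContinuous h)
    rw [h1] at h2
    exact ENNReal.ofReal_pos.1 (pos_iff_ne_zero.2 h2)
  have hE0 : volume E ≠ 0 := fun h => ht0.ne' (by simp [ht, Measure.real, h])
  set e := ∫ y in E, w y with he
  set W := ∫ y in D, w y with hWdef
  have he0 : 0 < e := hposint E hEQ hE0 hE
  have hW0 : 0 < W := hposint D subset_rfl (volume_cube_ne_zero x hl) hDm
  have hlog' : IntegrableOn (fun y => Real.log (w y)) D volume := by
    have := hlog.neg
    simpa only [Real.log_inv, Pi.neg_def, neg_neg] using this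
  set L := ∫ y in D, Real.log (w y) with hL
  have hAexp : Real.exp (-(L / m)) * (W / m) ≤ C' := by
    refine le_trans (le_of_eq ?_) (hA.trans (le_max_left C 1))
    rw [setAverage_eq, setAverage_eq]
    simp only [Real.log_inv, integral_neg, smul_eq_mul]
    congr 1
    · congr 1
      rw [mul_neg, div_eq_inv_mul]
    · rw [div_eq_inv_mul]
  have h1 : Real.log (W / m) ≤ Real.log C' + L / m := by
    have h2 := Real.log_le_log (by positivity) hAexp
    rw [Real.log_mul (Real.exp_ne_zero _) (by positivity), Real.log_exp] at h2
    linarith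
  -- On E the tangent is taken at the mean of w on E (Jensen); on the complement, at the mean over
  -- the whole cube, which also covers a null complement.
  have h2 := setIntegral_log_le hEt (hwD.mono_set hEQ) hW.2 (hlog'.mono_set hEQ)
    (a := e / t) (by positivity)
  have h3 := setIntegral_log_le (E := D \ E) (ne_top_of_le_ne_top hDt (measure_mono Set.sdiff_subset))
    (hwD.mono_set Set.sdiff_subset) hW.2 (hlog'.mono_set Set.sdiff_subset)
    (a := W / m) (by positivity)
  have h4 : (∫ y in E, Real.log (w y)) + ∫ y in D \ E, Real.log (w y) = L := by
    have := integral_inter_add_sdiff (f := fun y => Real.log (w y)) hE hlog'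
    rwa [Set.inter_eq_self_of_subset_right hEQ] at this
  have h5 : e + ∫ y in D \ E, w y = W := by
    have := integral_inter_add_sdiff (f := w) hE hwD
    rwa [Set.inter_eq_self_of_subset_right hEQ] at this
  have h6 : volume.real (D \ E) = m - t := measureReal_sdiff hEQ hE
  rw [h6] at h3
  have h7 : (∫ y in D \ E, w y) / (W / m) ≤ m := by
    rw [div_le_iff₀ (by positivity), mul_div_cancel₀ _ hm0.ne']
    linarith
  have h8 : e / (e / t) = t := by field_simp
  rw [← he, h8] at h2
  have htm' : t ≤ m := by
    exact ENNReal.toReal_mono hDt (measure_mono hEQ)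
  have h9 : m * Real.log (W / m) ≤ m * Real.log C' + L := by
    have := mul_le_mul_of_nonneg_left h1 hm0.le
    rwa [mul_add, mul_div_cancel₀ _ hm0.ne'] at this
  have h10 : t * Real.log (W / m) ≤ m * (Real.log C' + 1) + t * Real.log (e / t) := by
    nlinarith
  have h11 : Real.log (W / m) ≤ 2 * (Real.log C' + 1) + Real.log (e / t) := by
    have h12 : m * (Real.log C' + 1) ≤ 2 * t * (Real.log C' + 1) :=
      mul_le_mul_of_nonneg_right htm (by have := Real.log_nonneg hC1; linarith)
    refine le_of_mul_le_mul_left (a := t) ?_ ht0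
    linarith
  have h13 : W / m ≤ R * (e / t) := by
    have := Real.exp_le_exp.2 h11
    rwa [Real.exp_add, Real.exp_log (by positivity), Real.exp_log (by positivity)] at this
  have h14 : W ≤ 2 * R * e := by
    rw [div_le_iff₀ hm0] at h13
    have h15 : e / t * m ≤ e * 2 := by
      rw [div_mul_eq_mul_div, div_le_iff₀ ht0]
      nlinarith
    have hR0 : 0 < R := Real.exp_pos _
    nlinarith
  rw [hW.weightMeasure_eq_ofReal hDm subset_rfl, hW.weightMeasure_eq_ofReal hE hEQ,
    ← ENNReal.ofReal.eq_1, ← ENNReal.ofReal_mul (by positivity)]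
  exact ENNReal.ofReal_le_ofReal h14

end Cubes

/-! ### Shifted dyadic grids -/

section Grid

variable {d : ℕ}

/-- The relative shift of the `k`-th level of the second one-dimensional grid. -/
noncomputable def gridShift (k : ℤ) : ℝ := ((k.negOnePow : ℤ) : ℝ) / 3

theorem three_mul_gridShift (k : ℤ) : 3 * gridShift k = 1 ∨ 3 * gridShift k = -1 := by
  rcases Int.even_or_odd k with h | h
  · left; simp [gridShift, Int.negOnePow_even k h]
  · right; simp [gridShift, Int.negOnePow_odd k h]; norm_num

/-- The alternating sign is what makes the shifted grid nested: (-2)^n ≡ 1 mod 3. -/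
theorem exists_two_pow_mul_gridShift (j : ℤ) (n : ℕ) :
    ∃ N : ℤ, (2 : ℝ) ^ n * gridShift (j + n) = N + gridShift j := by
  have h1 : (-2 - 1 : ℤ) ∣ (-2) ^ n - 1 ^ n := sub_dvd_pow_sub_pow _ _ _
  obtain ⟨c, hc⟩ := h1
  have h2 : (((n : ℤ).negOnePow : ℤ) : ℝ) = (-1) ^ n := by
    rw [Int.negOnePow_def]
    simp
  have hc' : (2 : ℝ) ^ n * (-1) ^ n = 1 - 3 * c := by
    rw [← mul_pow]
    have : ((-2 : ℤ) : ℝ) ^ n - 1 ^ n = (-2 - 1) * c := by exact_mod_cast hc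
    norm_num at this ⊢
    linarith
  refine ⟨-(c * (j.negOnePow : ℤ)), ?_⟩
  rw [gridShift, gridShift, Int.negOnePow_add, Units.val_mul, Int.cast_mul, h2]
  push_cast
  linear_combination (((j.negOnePow : ℤ) : ℝ) / 3) * hc'

theorem exists_grid_nested {j k : ℤ} (hjk : j ≤ k) (t : ℤ) (m : ℤ) :
    ∃ N : ℤ, (2 : ℝ) ^ k * (m + t * gridShift k) = 2 ^ j * (N + t * gridShift j) := by
  obtain ⟨n, rfl⟩ := Int.le.dest hjk
  obtain ⟨N, hN⟩ := exists_two_pow_mul_gridShift j n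
  refine ⟨2 ^ n * m + t * N, ?_⟩
  rw [zpow_add₀ two_ne_zero, zpow_natCast]
  push_cast
  linear_combination (2 : ℝ) ^ j * t * hN

/-- The corner of a cube of a shifted dyadic grid. -/
noncomputable def gridCorner (t : Fin d → Fin 2) (i : ℤ × (Fin d → ℤ)) :
    EuclideanSpace ℝ (Fin d) :=
  WithLp.toLp 2 fun a => (2 : ℝ) ^ i.1 * (i.2 a + ((t a : ℕ) : ℤ) * gridShift i.1)

/-- The cubes of a shifted dyadic grid. -/
def gridCube (t : Fin d → Fin 2) (i : ℤ × (Fin d → ℤ)) : Set (EuclideanSpace ℝ (Fin d)) :=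
  cube (gridCorner t i) (2 ^ i.1)

theorem mem_gridCube_iff {t : Fin d → Fin 2} {i : ℤ × (Fin d → ℤ)}
    {x : EuclideanSpace ℝ (Fin d)} :
    x ∈ gridCube t i ↔ ∀ a, ⌊x a / 2 ^ i.1 - ((t a : ℕ) : ℤ) * gridShift i.1⌋ = i.2 a := by
  refine forall_congr' fun a => ?_
  have h2 : (0 : ℝ) < 2 ^ i.1 := by positivity
  rw [Int.floor_eq_iff, gridCorner, le_sub_iff_add_le, le_div_iff₀ h2, sub_lt_iff_lt_add,
    div_lt_iff₀ h2]
  simp only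
  refine and_congr ?_ ?_
  · rw [mul_comm]
  · rw [show (2 : ℝ) ^ i.1 * (i.2 a + ((t a : ℕ) : ℤ) * gridShift i.1) + 2 ^ i.1
      = ((i.2 a : ℝ) + 1 + ((t a : ℕ) : ℤ) * gridShift i.1) * 2 ^ i.1 by ring]

theorem isLaminar_gridCube (t : Fin d → Fin 2) : IsLaminar (gridCube t) Prod.fst := by
  refine ⟨fun i => measurableSet_cube _ _, fun i j hij hne => ?_⟩
  by_cases hd : Disjoint (gridCube t i) (gridCube t j)
  · exact Or.inl hd
  right
  obtain ⟨x, hxi, hxj⟩ := Set.not_disjoint_iff.1 hd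
  have hlt : i.1 < j.1 := by
    refine lt_of_le_of_ne hij fun h => hne (Prod.ext h (funext fun a => ?_))
    rw [mem_gridCube_iff] at hxi hxj
    rw [← hxi a, ← hxj a, h]
  refine ⟨hlt, fun y hy a => ?_⟩
  obtain ⟨N, hN⟩ := exists_grid_nested hij ((t a : ℕ) : ℤ) (j.2 a)
  have hi0 : (0 : ℝ) < 2 ^ i.1 := by positivity
  have hxi := hxi a
  have hxj := hxj a
  have hy := hy a
  simp only [gridCorner] at hxi hxj hy ⊢
  obtain ⟨n, hn⟩ := Int.le.dest hij
  have hpow : (2 : ℝ) ^ j.1 = 2 ^ i.1 * (2 ^ n : ℤ) := by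
    rw [← hn, zpow_add₀ two_ne_zero, zpow_natCast]
    push_cast
    rfl
  rw [hN, hpow] at hxj ⊢
  set u := (((t a : ℕ) : ℤ) : ℝ) * gridShift i.1
  have e1 : N < i.2 a + 1 := by
    have : (2 : ℝ) ^ i.1 * (N + u) < 2 ^ i.1 * (i.2 a + 1 + u) := by linarith [hxi.2, hxj.1]
    have := lt_of_mul_lt_mul_left this hi0.le
    have h3 : (N : ℝ) < i.2 a + 1 := by linarith
    exact_mod_cast h3
  have e2 : i.2 a < N + 2 ^ n := by
    have : (2 : ℝ) ^ i.1 * (i.2 a + u) < 2 ^ i.1 * (N + u + (2 ^ n : ℤ)) := by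
      linarith [hxi.1, hxj.2]
    have := lt_of_mul_lt_mul_left this hi0.le
    have h3 : (i.2 a : ℝ) < N + (2 ^ n : ℤ) := by linarith
    exact_mod_cast h3
  have e1' : (N : ℝ) ≤ i.2 a := by exact_mod_cast Int.lt_add_one_iff.1 e1
  have e2' : (i.2 a : ℝ) + 1 ≤ N + (2 ^ n : ℤ) := by exact_mod_cast Int.add_one_le_iff.2 e2
  have f1 : (2 : ℝ) ^ i.1 * (N + u) ≤ 2 ^ i.1 * (i.2 a + u) :=
    mul_le_mul_of_nonneg_left (by linarith) hi0.le
  have f2 : (2 : ℝ) ^ i.1 * (i.2 a + u + 1) ≤ 2 ^ i.1 * (N + u + (2 ^ n : ℤ)) :=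
    mul_le_mul_of_nonneg_left (by linarith) hi0.le
  constructor <;> linarith [hy.1, hy.2]

/-- One-third trick: points of ℤ and of ℤ + s are at least 1/3 apart, so an interval shorter than
1/3 cannot meet both. -/
theorem exists_floor_eq {u v s : ℝ} (huv : |u - v| < 1 / 3) (hs : 3 * s = 1 ∨ 3 * s = -1) :
    ∃ t : Fin 2, ⌊u - ((t : ℕ) : ℤ) * s⌋ = ⌊v - ((t : ℕ) : ℤ) * s⌋ := by
  wlog hle : u ≤ v generalizing u v
  · obtain ⟨t, ht⟩ := this (by rwa [abs_sub_comm]) (le_of_not_ge hle)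
    exact ⟨t, ht.symm⟩
  rw [abs_sub_comm, abs_of_nonneg (by linarith)] at huv
  by_contra! hcon
  have h0 := hcon 0
  have h1 := hcon 1
  simp only [Fin.val_zero, Fin.val_one, Nat.cast_zero, Nat.cast_one, Int.cast_zero, Int.cast_one,
    zero_mul, one_mul, sub_zero] at h0 h1
  have key : ∀ x y : ℝ, x ≤ y → ⌊x⌋ ≠ ⌊y⌋ → x < ⌊y⌋ := fun x y hxy hne => by
    have := lt_of_le_of_ne (Int.floor_mono hxy) hne
    exact Int.floor_lt.1 this
  have a1 := key _ _ hle h0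
  have a2 := key _ _ (by linarith : u - s ≤ v - s) h1
  have b1 := Int.floor_le v
  have b2 := Int.floor_le (v - s)
  set n := ⌊v⌋
  set n' := ⌊v - s⌋
  have c1 : (3 * (n - n') : ℝ) - 3 * s < 1 := by linarith
  have c2 : -1 < (3 * (n - n') : ℝ) - 3 * s := by linarith
  rcases hs with hs | hs <;> rw [hs] at c1 c2
  · have d1 : 3 * (n - n') - 1 < 1 := by exact_mod_cast c1
    have d2 : -1 < 3 * (n - n') - 1 := by exact_mod_cast c2
    omega
  · have d1 : 3 * (n - n') - -1 < 1 := by exact_mod_cast c1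
    have d2 : -1 < 3 * (n - n') - -1 := by exact_mod_cast c2
    omega

theorem exists_mem_gridCube {x y : EuclideanSpace ℝ (Fin d)} {k : ℤ} (hxy : 3 * ‖x - y‖ < 2 ^ k) :
    ∃ (t : Fin d → Fin 2) (m : Fin d → ℤ), x ∈ gridCube t (k, m) ∧ y ∈ gridCube t (k, m) := by
  have h2 : (0 : ℝ) < 2 ^ k := by positivity
  have h : ∀ a, ∃ t : Fin 2, ⌊x a / 2 ^ k - ((t : ℕ) : ℤ) * gridShift k⌋
      = ⌊y a / 2 ^ k - ((t : ℕ) : ℤ) * gridShift k⌋ := by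
    intro a
    refine exists_floor_eq ?_ (three_mul_gridShift k)
    rw [← sub_div, abs_div, abs_of_pos h2, div_lt_iff₀ h2]
    have := PiLp.norm_apply_le (x - y) a
    rw [PiLp.sub_apply, Real.norm_eq_abs] at this
    linarith
  choose t ht using h
  exact ⟨t, fun a => ⌊x a / 2 ^ k - ((t a : ℕ) : ℤ) * gridShift k⌋,
    mem_gridCube_iff.2 fun a => rfl, mem_gridCube_iff.2 fun a => (ht a).symm⟩

theorem volume_gridCube (t : Fin d → Fin 2) (i : ℤ × (Fin d → ℤ)) :
    volume (gridCube t i) = 2 ^ ((d : ℝ) * i.1) := by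
  rw [gridCube, volume_cube, ← Real.rpow_intCast, ← ENNReal.ofReal_rpow_of_pos two_pos,
    ← ENNReal.rpow_natCast, ← ENNReal.rpow_mul, mul_comm]
  simp

/-- The fractional kernel is dominated by finitely many dyadic kernels. -/
theorem ofReal_norm_sub_rpow_le {α : ℝ} (hαd : α < d) (x y : EuclideanSpace ℝ (Fin d)) :
    ENNReal.ofReal (‖x - y‖ ^ (α - d)) ≤ ENNReal.ofReal (6 ^ ((d : ℝ) - α)) *
      ∑ t : Fin d → Fin 2, ∑' i, (gridCube t i).indicator
        (fun _ => 2 ^ ((α - d) * i.1) * (gridCube t i).indicator (fun _ => 1) y) x := by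
  -- On the diagonal the real power of 0 with nonzero exponent is 0 by convention.
  rcases eq_or_ne x y with rfl | hxy
  · rw [sub_self, norm_zero, Real.zero_rpow (by linarith), ENNReal.ofReal_zero]
    exact zero_le
  have hpos : 0 < ‖x - y‖ := norm_pos_iff.2 (sub_ne_zero.2 hxy)
  -- A common cube has side 2^(n+1), at most twice 3|x - y|: hence the factor 6.
  obtain ⟨n, hn1, hn2⟩ := exists_mem_Ico_zpow (x := 3 * ‖x - y‖) (y := (2 : ℝ)) (by positivity)
    one_lt_two
  obtain ⟨t, m, hx, hy⟩ := exists_mem_gridCube hn2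
  refine le_trans ?_ (mul_le_mul_right ((ENNReal.le_tsum (n + 1, m)).trans
    (Finset.single_le_sum (f := fun t => ∑' i, (gridCube t i).indicator
        (fun _ => (2 : ℝ≥0∞) ^ ((α - d) * i.1) * (gridCube t i).indicator (fun _ => 1) y) x)
      (fun _ _ => zero_le) (Finset.mem_univ t))) _)
  rw [Set.indicator_of_mem hx, Set.indicator_of_mem hy, mul_one]
  have h2 : (2 : ℝ≥0∞) ^ ((α - d) * ((n + 1 : ℤ) : ℝ))
      = ENNReal.ofReal (((2 : ℝ) ^ (n + 1)) ^ (α - d)) := by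
    rw [← Real.rpow_intCast, ← Real.rpow_mul two_pos.le, ← ENNReal.ofReal_rpow_of_pos two_pos,
      mul_comm]
    simp
  rw [h2, ← ENNReal.ofReal_mul (by positivity)]
  refine ENNReal.ofReal_le_ofReal ?_
  have h3 : (2 : ℝ) ^ (n + 1) ≤ 6 * ‖x - y‖ := by
    rw [zpow_add₀ two_ne_zero, zpow_one]
    linarith
  have h4 : (6 * ‖x - y‖) ^ (α - d) ≤ ((2 : ℝ) ^ (n + 1)) ^ (α - d) :=
    Real.rpow_le_rpow_of_nonpos (by positivity) h3 (by linarith)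
  rw [Real.mul_rpow (by norm_num) hpos.le] at h4
  have h5 : (6 : ℝ) ^ ((d : ℝ) - α) * 6 ^ (α - d) = 1 := by
    rw [← Real.rpow_add (by norm_num)]
    simp
  calc ‖x - y‖ ^ (α - d) = 6 ^ ((d : ℝ) - α) * (6 ^ (α - d) * ‖x - y‖ ^ (α - d)) := by
        rw [← mul_assoc, h5, one_mul]
    _ ≤ _ := by gcongr

end Grid

/-! ### The two-weight inequality -/

section TwoWeightInequality

variable {d : ℕ}

/-- The substitution g = |f|/σ; the norms agree because v = σ · σ^(-p). -/
theorem exists_density_dualWeight {p : ℝ} (hp : 1 < p) {v : EuclideanSpace ℝ (Fin d) → ℝ}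
    (hv : IsWeight v) (hσ : IsWeight (dualWeight p v)) {f : EuclideanSpace ℝ (Fin d) → ℂ}
    (hf : AEStronglyMeasurable f volume) :
    ∃ g : EuclideanSpace ℝ (Fin d) → ℝ≥0, Measurable g ∧
      (∀ A, MeasurableSet A →
        ∫⁻ x in A, g x ∂weightMeasure (dualWeight p v) = ∫⁻ x in A, ‖f x‖ₑ) ∧
      ∫⁻ x, (g x : ℝ≥0∞) ^ p ∂weightMeasure (dualWeight p v)
        = ∫⁻ x, ‖f x‖ₑ ^ p ∂weightMeasure v := by
  have hp0 : 0 < p := by linarith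
  set s := dualWeight p v with hs
  obtain ⟨f', hf', hff'⟩ := hf
  obtain ⟨s', hs', hss'⟩ := hσ.aemeasurable
  have hgm : Measurable fun x => ‖f' x‖₊ / (s' x).toNNReal :=
    hf'.measurable.nnnorm.div hs'.real_toNNReal
  have hsm := hσ.aemeasurable.ennreal_ofReal
  have hvm := hv.aemeasurable.ennreal_ofReal
  have hfm : AEMeasurable (fun x => ‖f x‖ₑ) volume :=
    AEStronglyMeasurable.enorm ⟨f', hf', hff'⟩
  refine ⟨_, hgm, fun A hA => ?_, ?_⟩
  · rw [weightMeasure, setLIntegral_withDensity_eq_lintegral_mul₀ hsm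
      hgm.coe_nnreal_ennreal.aemeasurable hA]
    refine lintegral_congr_ae (ae_restrict_of_ae ?_)
    filter_upwards [hff', hss', hσ.2] with x h1 h2 h3
    rw [Pi.mul_apply, h1, ← h2]
    have h4 : (s x).toNNReal ≠ 0 := (Real.toNNReal_pos.2 h3).ne'
    rw [ENNReal.ofReal, ENNReal.coe_div h4, ENNReal.mul_div_cancel (by simpa using h4) (by simp)]
    rfl
  · rw [weightMeasure, weightMeasure, lintegral_withDensity_eq_lintegral_mul₀ hsm
      (hgm.coe_nnreal_ennreal.pow_const _).aemeasurable,
      lintegral_withDensity_eq_lintegral_mul₀ hvm (hfm.pow_const _)]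
    refine lintegral_congr_ae ?_
    filter_upwards [hff', hss', hσ.2, hv.2] with x h1 h2 h3 h5
    rw [Pi.mul_apply, Pi.mul_apply, h1, ← h2]
    have h4 : (s x).toNNReal ≠ 0 := (Real.toNNReal_pos.2 h3).ne'
    have hpp : 0 < p - 1 := by linarith
    have key : v x = s x * (s x) ^ (-p) := by
      have h6 : s x * (s x) ^ (-p) = s x ^ (1 + -p) := by
        rw [Real.rpow_add h3, Real.rpow_one]
      rw [h6, hs, dualWeight, ← Real.rpow_mul h5.le, Real.conjExponent]
      have : -(p / (p - 1) / p) * (1 + -p) = 1 := by field_simp; ring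
      rw [this, Real.rpow_one]
    have key' : ENNReal.ofReal (v x) = ENNReal.ofReal (s x) * (ENNReal.ofReal (s x)) ^ (-p) := by
      rw [key, ENNReal.ofReal_mul h3.le, ENNReal.ofReal_rpow_of_pos h3]
    rw [key', mul_assoc, ENNReal.coe_div h4, div_eq_mul_inv,
      ENNReal.mul_rpow_of_nonneg _ _ hp0.le, ENNReal.inv_rpow, ← ENNReal.rpow_neg, mul_comm (_ ^ p)]
    rfl

theorem exists_twoWeight_gridCube {p q α : ℝ} (hd : 0 < d)
    {v w : EuclideanSpace ℝ (Fin d) → ℝ} (hApq : IsApq p q α v w)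
    (hσ : IsAInfty (dualWeight p v)) (hw : IsAInfty w) :
    ∃ K Cσ Cω : ℝ≥0, ∀ t : Fin d → Fin 2, IsLaminar.TwoWeight (gridCube t) Prod.fst volume
      (weightMeasure (dualWeight p v)) (weightMeasure w) d α p q K Cσ Cω := by
  obtain ⟨Cσ, hCσ⟩ := hσ.exists_measure_le
  obtain ⟨Cω, hCω⟩ := hw.exists_measure_le
  refine ⟨(apqConst p q α v w).toNNReal, Cσ, Cω, fun t => ?_⟩
  have h2 : ∀ i : ℤ × (Fin d → ℤ), (0 : ℝ) < 2 ^ i.1 := fun i => by positivity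
  refine ⟨isLaminar_gridCube t, volume_gridCube t,
    fun i => hσ.1.weightMeasure_cube_ne_zero _ (h2 i), fun i => hσ.1.weightMeasure_cube_ne_top _ _,
    fun i => hw.1.weightMeasure_cube_ne_zero _ (h2 i), fun i => hw.1.weightMeasure_cube_ne_top _ _,
    fun i => ?_, fun i => hCσ _ _ (h2 i), fun i => hCω _ _ (h2 i)⟩
  rw [ENNReal.coe_toNNReal (ne_of_lt hApq)]
  have hd' : (d : ℝ) ≠ 0 := by positivity
  have e : (2 : ℝ≥0∞) ^ ((α - d) * i.1) = volume (gridCube t i) ^ (α / d - 1) := by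
    rw [volume_gridCube, ← ENNReal.rpow_mul]
    congr 1
    field_simp
  rw [e, gridCube, weightMeasure_apply (measurableSet_cube _ _),
    weightMeasure_apply (measurableSet_cube _ _)]
  exact le_iSup_of_le (gridCorner t i) (le_iSup_of_le (2 ^ i.1) (le_iSup_of_le (h2 i) le_rfl))

theorem lintegral_enorm_rieszIntegrand {α : ℝ} (f : EuclideanSpace ℝ (Fin d) → ℂ)
    (x : EuclideanSpace ℝ (Fin d)) :
    ∫⁻ y, ‖rieszIntegrand α f x y‖ₑ = ∫⁻ y, ENNReal.ofReal (‖x - y‖ ^ (α - d)) * ‖f y‖ₑ := by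
  rw [← lintegral_sub_left_eq_self _ x]
  refine lintegral_congr fun y => ?_
  rw [rieszIntegrand, sub_sub_cancel, enorm_mul]
  congr 1
  rw [← ofReal_norm, Complex.norm_real, Real.norm_of_nonneg (by positivity)]

theorem lintegral_enorm_rieszIntegrand_le {α : ℝ} (hαd : α < d)
    {f : EuclideanSpace ℝ (Fin d) → ℂ} (hf : AEStronglyMeasurable f volume)
    (x : EuclideanSpace ℝ (Fin d)) :
    ∫⁻ y, ‖rieszIntegrand α f x y‖ₑ ≤ ENNReal.ofReal (6 ^ ((d : ℝ) - α)) *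
      ∑ t : Fin d → Fin 2, ∑' i, (gridCube t i).indicator
        (fun _ => 2 ^ ((α - d) * i.1) * ∫⁻ y in gridCube t i, ‖f y‖ₑ) x := by
  have hm : ∀ t : Fin d → Fin 2, ∀ i : ℤ × (Fin d → ℤ), MeasurableSet (gridCube t i) :=
    fun t i => measurableSet_cube _ _
  have hfm := hf.enorm
  rw [lintegral_enorm_rieszIntegrand]
  have hterm : ∀ (t : Fin d → Fin 2) (i : ℤ × (Fin d → ℤ)) (y : EuclideanSpace ℝ (Fin d)),
      (gridCube t i).indicator
        (fun _ => (2 : ℝ≥0∞) ^ ((α - d) * i.1) * (gridCube t i).indicator (fun _ => 1) y) x * ‖f y‖ₑ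
      = (gridCube t i).indicator (fun _ => (2 : ℝ≥0∞) ^ ((α - d) * i.1)) x *
          (gridCube t i).indicator (fun y => ‖f y‖ₑ) y := by
    intro t i y
    by_cases hx : x ∈ gridCube t i <;> by_cases hy : y ∈ gridCube t i <;> simp [hx, hy]
  have hterm_m : ∀ (t : Fin d → Fin 2) (i : ℤ × (Fin d → ℤ)), AEMeasurable (fun y =>
      (gridCube t i).indicator (fun _ => (2 : ℝ≥0∞) ^ ((α - d) * i.1)) x *
          (gridCube t i).indicator (fun y => ‖f y‖ₑ) y) volume := fun t i =>
    (hfm.indicator (hm t i)).const_mul _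
  calc ∫⁻ y, ENNReal.ofReal (‖x - y‖ ^ (α - d)) * ‖f y‖ₑ
      ≤ ∫⁻ y, ENNReal.ofReal (6 ^ ((d : ℝ) - α)) * ∑ t : Fin d → Fin 2, ∑' i,
          ((gridCube t i).indicator (fun _ => (2 : ℝ≥0∞) ^ ((α - d) * i.1)) x *
          (gridCube t i).indicator (fun y => ‖f y‖ₑ) y) := by
        refine lintegral_mono fun y => ?_
        refine (mul_le_mul_left (ofReal_norm_sub_rpow_le hαd x y) _).trans (le_of_eq ?_)
        rw [mul_assoc, Finset.sum_mul]
        congr 1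
        refine Finset.sum_congr rfl fun t _ => ?_
        rw [← ENNReal.tsum_mul_right]
        exact tsum_congr fun i => hterm t i y
    _ = _ := by
        rw [lintegral_const_mul' _ _ ENNReal.ofReal_ne_top, lintegral_finsetSum' _ fun t _ =>
          AEMeasurable.tsum (hterm_m t)]
        congr 1
        refine Finset.sum_congr rfl fun t _ => ?_
        rw [lintegral_tsum (hterm_m t)]
        refine tsum_congr fun i => ?_
        rw [lintegral_const_mul'' _ (hfm.indicator (hm t i)), lintegral_indicator (hm t i)]
        by_cases hx : x ∈ gridCube t i <;> simp [hx]

theorem aestronglyMeasurable_rieszIntegrand (α : ℝ) {f : EuclideanSpace ℝ (Fin d) → ℂ}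
    (hf : AEStronglyMeasurable f volume) (x : EuclideanSpace ℝ (Fin d)) :
    AEStronglyMeasurable (rieszIntegrand α f x) volume := by
  refine AEStronglyMeasurable.mul ?_
    (hf.comp_quasiMeasurePreserving (quasiMeasurePreserving_sub_left volume x))
  exact (Complex.measurable_ofReal.comp (measurable_norm.pow_const _)).aestronglyMeasurable

theorem aestronglyMeasurable_rieszIntegrand_prod (α : ℝ) {f : EuclideanSpace ℝ (Fin d) → ℂ}
    (hf : AEStronglyMeasurable f volume) :
    AEStronglyMeasurable (fun z : EuclideanSpace ℝ (Fin d) × EuclideanSpace ℝ (Fin d) =>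
      rieszIntegrand α f z.1 z.2) (volume.prod volume) := by
  refine AEStronglyMeasurable.mul ?_ (hf.comp_quasiMeasurePreserving
    (quasiMeasurePreserving_sub_of_right_invariant volume volume))
  exact (Complex.measurable_ofReal.comp (measurable_snd.norm.pow_const _)).aestronglyMeasurable

theorem aestronglyMeasurable_rieszPotential (α : ℝ) {f : EuclideanSpace ℝ (Fin d) → ℂ}
    (hf : AEStronglyMeasurable f volume) :
    AEStronglyMeasurable (rieszPotential α f) volume :=
  (aestronglyMeasurable_rieszIntegrand_prod α hf).integral_prod_right'

/-- The estimate is proved for the integral of the absolute value of the integrand, so it yields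
a.e. absolute convergence as well as the norm bound. -/
theorem exists_eLpNorm_rieszPotential_le {p q α : ℝ} (hp : 1 < p) (hpq : p ≤ q) (hα : 0 < α)
    (hαd : α < d) {v w : EuclideanSpace ℝ (Fin d) → ℝ} (hv : IsWeight v) (hw : IsWeight w)
    (hApq : IsApq p q α v w) (hσ : IsAInfty (dualWeight p v)) (hw' : IsAInfty w) :
    ∃ C : ℝ≥0, ∀ f : EuclideanSpace ℝ (Fin d) → ℂ,
      MemLp f (ENNReal.ofReal p) (weightMeasure v) →
      (∀ᵐ x, Integrable (rieszIntegrand α f x) volume) ∧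
      MemLp (rieszPotential α f) (ENNReal.ofReal q) (weightMeasure w) ∧
      eLpNorm (rieszPotential α f) (ENNReal.ofReal q) (weightMeasure w)
        ≤ C * eLpNorm f (ENNReal.ofReal p) (weightMeasure v) := by
  have hp0 : 0 < p := by linarith
  have hq1 : 1 < q := by linarith
  have hq0 : 0 < q := by linarith
  have hd : 0 < d := by
    have : (0 : ℝ) < d := hα.trans hαd
    exact_mod_cast this
  have hpp := Real.HolderConjugate.conjExponent hp
  obtain ⟨K, Cσ, Cω, hT⟩ := exists_twoWeight_gridCube hd hApq hσ hw'
  set A := IsLaminar.twoWeightConst α p q K Cσ Cω with hA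
  have hAt : A ≠ ∞ := IsLaminar.twoWeightConst_ne_top hα hp hq1 ENNReal.coe_ne_top
    ENNReal.coe_ne_top ENNReal.coe_ne_top
  set B := ENNReal.ofReal (6 ^ ((d : ℝ) - α)) with hB
  set N : ℝ≥0∞ := ((Finset.univ : Finset (Fin d → Fin 2)).card : ℝ≥0∞) with hN
  have hCt : B * N * A ≠ ∞ :=
    ENNReal.mul_ne_top (ENNReal.mul_ne_top ENNReal.ofReal_ne_top (ENNReal.natCast_ne_top _)) hAt
  refine ⟨(B * N * A).toNNReal, fun f hf => ?_⟩
  rw [ENNReal.coe_toNNReal hCt]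
  have hfm : AEStronglyMeasurable f volume := hf.1.mono_ac hv.volume_absolutelyContinuous
  obtain ⟨g, hgm, hgA, hgp⟩ := exists_density_dualWeight hp hv hσ.1 hfm
  have hnorm : eLpNorm f (ENNReal.ofReal p) (weightMeasure v)
      = (∫⁻ x, (g x : ℝ≥0∞) ^ p ∂weightMeasure (dualWeight p v)) ^ (1 / p) := by
    rw [eLpNorm_eq_lintegral_rpow_enorm_toReal (ENNReal.ofReal_pos.2 hp0).ne' ENNReal.ofReal_ne_top,
      ENNReal.toReal_ofReal hp0.le, hgp]
  -- Hölder's inequality on the cube against the constant 1.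
  have hgQ : ∀ (t : Fin d → Fin 2) i,
      ∫⁻ x in gridCube t i, g x ∂weightMeasure (dualWeight p v) ≠ ∞ := by
    intro t i
    have h1 := ENNReal.lintegral_mul_le_Lp_mul_Lq
      ((weightMeasure (dualWeight p v)).restrict (gridCube t i)) hpp
      hgm.coe_nnreal_ennreal.aemeasurable (aemeasurable_const (b := (1 : ℝ≥0∞)))
    simp only [Pi.mul_apply, mul_one, ENNReal.one_rpow, lintegral_const, one_mul,
      Measure.restrict_apply_univ] at h1
    refine ne_top_of_le_ne_top (ENNReal.mul_ne_top ?_ ?_) h1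
    · refine ne_top_of_le_ne_top ?_ (ENNReal.rpow_le_rpow
        (lintegral_mono' Measure.restrict_le_self le_rfl) (by positivity))
      rw [← hnorm]
      exact hf.2.ne
    · exact ENNReal.rpow_ne_top_of_nonneg (by have := hpp.symm.pos; positivity)
        ((hT t).left_ne_top i)
  set F : EuclideanSpace ℝ (Fin d) → ℝ≥0∞ := fun x => ∫⁻ y, ‖rieszIntegrand α f x y‖ₑ with hF
  set u : (Fin d → Fin 2) → EuclideanSpace ℝ (Fin d) → ℝ≥0∞ := fun t x => ∑' i,
    (gridCube t i).indicator (fun _ => 2 ^ ((α - d) * i.1) *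
      ∫⁻ x in gridCube t i, g x ∂weightMeasure (dualWeight p v)) x with hu
  have hum : ∀ t, Measurable (u t) := fun t => Measurable.tsum fun i =>
    measurable_const.indicator (measurableSet_cube _ _)
  have hFu : ∀ x, F x ≤ B * ∑ t, u t x := by
    intro x
    refine (lintegral_enorm_rieszIntegrand_le hαd hfm x).trans (le_of_eq ?_)
    congr 1
    refine Finset.sum_congr rfl fun t _ => tsum_congr fun i => ?_
    rw [hgA (gridCube t i) (measurableSet_cube _ _)]
  have hut : ∀ t, ∫⁻ x, u t x ^ q ∂weightMeasure w
      ≤ (A * eLpNorm f (ENNReal.ofReal p) (weightMeasure v)) ^ q := fun t => by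
    rw [hnorm]
    exact (hT t).lintegral_tsum_rpow_le hp hpq hgm (hgQ t)
  have hFq : ∫⁻ x, F x ^ q ∂weightMeasure w
      ≤ (B * N * A * eLpNorm f (ENNReal.ofReal p) (weightMeasure v)) ^ q := by
    calc ∫⁻ x, F x ^ q ∂weightMeasure w
        ≤ ∫⁻ x, B ^ q * (N ^ (q - 1) * ∑ t, u t x ^ q) ∂weightMeasure w := by
          refine lintegral_mono fun x => (ENNReal.rpow_le_rpow (hFu x) hq0.le).trans ?_
          rw [ENNReal.mul_rpow_of_nonneg _ _ hq0.le]
          gcongr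
          exact ENNReal.rpow_sum_le_const_mul_sum_rpow _ _ hq1.le
      _ = B ^ q * (N ^ (q - 1) * ∑ t, ∫⁻ x, u t x ^ q ∂weightMeasure w) := by
          rw [lintegral_const_mul, lintegral_const_mul, lintegral_finsetSum]
          · exact fun t _ => (hum t).pow_const _
          · exact Finset.measurable_fun_sum _ fun t _ => (hum t).pow_const _
          · exact (Finset.measurable_fun_sum _ fun t _ => (hum t).pow_const _).const_mul _
      _ ≤ B ^ q * (N ^ (q - 1) * ∑ _t : Fin d → Fin 2,
            (A * eLpNorm f (ENNReal.ofReal p) (weightMeasure v)) ^ q) := by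
          gcongr with t
          exact hut t
      _ = _ := by
          rw [Finset.sum_const, nsmul_eq_mul, ← mul_assoc (N ^ (q - 1)), ← hN]
          have hNq : N ^ (q - 1) * N = N ^ q := by
            conv_rhs => rw [show q = (q - 1) + 1 by ring,
              ENNReal.rpow_add_of_nonneg _ _ (by linarith) zero_le_one, ENNReal.rpow_one]
          rw [hNq, ← ENNReal.mul_rpow_of_nonneg _ _ hq0.le, ← ENNReal.mul_rpow_of_nonneg _ _ hq0.le]
          congr 1
          ring
  have hbound_t : B * N * A * eLpNorm f (ENNReal.ofReal p) (weightMeasure v) ≠ ∞ :=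
    ENNReal.mul_ne_top hCt hf.2.ne
  have hle : eLpNorm (rieszPotential α f) (ENNReal.ofReal q) (weightMeasure w)
      ≤ B * N * A * eLpNorm f (ENNReal.ofReal p) (weightMeasure v) := by
    rw [eLpNorm_eq_lintegral_rpow_enorm_toReal (ENNReal.ofReal_pos.2 hq0).ne' ENNReal.ofReal_ne_top,
      ENNReal.toReal_ofReal hq0.le, one_div, ENNReal.rpow_inv_le_iff hq0]
    refine le_trans (lintegral_mono fun x => ?_) hFq
    gcongr
    exact enorm_integral_le_lintegral_enorm _
  have hFm : AEMeasurable F (weightMeasure w) :=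
    ((aestronglyMeasurable_rieszIntegrand_prod α hfm).enorm.lintegral_prod_right').mono_ac
      (weightMeasure_absolutelyContinuous w)
  refine ⟨?_, ⟨(aestronglyMeasurable_rieszPotential α hfm).mono_ac
    (weightMeasure_absolutelyContinuous w), hle.trans_lt hbound_t.lt_top⟩, hle⟩
  have hFt : ∀ᵐ x ∂weightMeasure w, F x ^ q < ∞ :=
    ae_lt_top' (hFm.pow_const _)
      (ne_top_of_le_ne_top (ENNReal.rpow_ne_top_of_nonneg hq0.le hbound_t) hFq)
  -- Since w > 0 a.e., finiteness w dx-a.e. is finiteness Lebesgue-a.e.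
  filter_upwards [hw.volume_absolutelyContinuous.ae_le hFt] with x hx
  exact ⟨aestronglyMeasurable_rieszIntegrand α hfm x, (ENNReal.rpow_lt_top_iff_of_pos hq0).1 hx⟩

end TwoWeightInequality

/-! ### Power weights -/

section PowerWeight

variable {d : ℕ}

theorem ae_ne_zero_euclideanSpace (hd : 0 < d) : ∀ᵐ x : EuclideanSpace ℝ (Fin d), x ≠ 0 := by
  have : Nonempty (Fin d) := ⟨⟨0, hd⟩⟩
  rw [ae_iff]
  simp

theorem measurable_powerWeight (a : ℝ) : Measurable (powerWeight (d := d) a) :=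
  measurable_norm.pow_const _

theorem isWeight_powerWeight (hd : 0 < d) {a : ℝ} (ha : -(d : ℝ) < a) :
    IsWeight (powerWeight (d := d) a) := by
  refine ⟨locallyIntegrable_of_norm_le_rpow (C := 1) (α := -a) ?_ ?_ ?_
    (measurable_powerWeight a).aestronglyMeasurable, ?_⟩
  · rw [finrank_euclideanSpace_fin]
    exact hd
  · rw [finrank_euclideanSpace_fin]
    linarith
  · refine Filter.Eventually.of_forall fun x => ?_
    rw [neg_neg, one_mul, powerWeight, Real.norm_of_nonneg (by positivity)]
  · filter_upwards [ae_ne_zero_euclideanSpace hd] with x hx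
    exact Real.rpow_pos_of_pos (norm_pos_iff.2 hx) _

theorem Real.rpow_le_rpow_abs_mul_rpow {c r ρ : ℝ} (a : ℝ) (hr : 0 < r) (hρ : 0 < ρ)
    (h1 : ρ ≤ c * r) (h2 : r ≤ c * ρ) : r ^ a ≤ c ^ |a| * ρ ^ a := by
  have hc : 0 < c := by
    by_contra! h
    nlinarith
  rcases le_total 0 a with ha | ha
  · rw [abs_of_nonneg ha, ← Real.mul_rpow hc.le hρ.le]
    exact Real.rpow_le_rpow hr.le h2 ha
  · rw [abs_of_nonpos ha, Real.rpow_neg hc.le, ← Real.inv_rpow hc.le,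
      ← Real.mul_rpow (by positivity) hρ.le]
    refine Real.rpow_le_rpow_of_nonpos (by positivity) ?_ ha
    rw [inv_mul_le_iff₀ hc]
    exact h1

theorem setIntegral_ball_powerWeight (a : ℝ) {R : ℝ} (hR : 0 < R) :
    ∫ y in Metric.ball 0 R, powerWeight (d := d) a y
      = R ^ d * R ^ a * ∫ y in Metric.ball 0 1, powerWeight (d := d) a y := by
  have h := Measure.setIntegral_comp_smul_of_pos (volume : Measure (EuclideanSpace ℝ (Fin d)))
    (powerWeight a) (Metric.ball 0 1) hR
  rw [smul_unitBall_of_pos hR, finrank_euclideanSpace_fin] at h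
  have h2 : ∀ y : EuclideanSpace ℝ (Fin d), powerWeight a (R • y) = R ^ a * powerWeight a y := by
    intro y
    rw [powerWeight, powerWeight, norm_smul, Real.norm_of_nonneg hR.le,
      Real.mul_rpow hR.le (norm_nonneg _)]
  simp only [h2, integral_const_mul, smul_eq_mul] at h
  rw [mul_assoc, h, mul_inv_cancel_left₀ (by positivity)]

theorem volume_real_cube (x : EuclideanSpace ℝ (Fin d)) {l : ℝ} (hl : 0 ≤ l) :
    volume.real (cube x l) = l ^ d := by
  rw [Measure.real, volume_cube, ENNReal.toReal_pow, ENNReal.toReal_ofReal hl]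

/-- Far from the origin, |y| is comparable to l + |x| on the whole cube. Near it, the cube lies in a
ball of radius comparable to l, where scaling gives l^(d+a), and l is comparable to l + |x|. -/
theorem exists_setIntegral_cube_powerWeight_le (hd : 0 < d) {a : ℝ} (ha : -(d : ℝ) < a) :
    ∃ C : ℝ, 0 < C ∧ ∀ (x : EuclideanSpace ℝ (Fin d)) (l : ℝ), 0 < l →
      ∫ y in cube x l, powerWeight a y ≤ C * l ^ d * (l + ‖x‖) ^ a := by
  have hW := isWeight_powerWeight hd ha
  have hs1 : 1 ≤ √(d : ℝ) := Real.one_le_sqrt.2 (by exact_mod_cast hd)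
  set s := √(d : ℝ) with hs
  set J := ∫ y in Metric.ball 0 1, powerWeight (d := d) a y with hJ
  have hpw : ∀ y : EuclideanSpace ℝ (Fin d), 0 ≤ powerWeight a y := fun y => by
    unfold powerWeight; positivity
  have hJ0 : 0 ≤ J := integral_nonneg hpw
  refine ⟨3 ^ |a| + (4 * s) ^ d * (4 * s) ^ a * (1 + 2 * s) ^ |a| * J, by positivity,
    fun x l hl => ?_⟩
  set ρ := l + ‖x‖ with hρ
  have hρ0 : 0 < ρ := by positivity
  rcases le_or_gt (2 * s * l) ‖x‖ with hfar | hnear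
  · have hbd : ∀ y ∈ cube x l, ‖powerWeight a y‖ ≤ 3 ^ |a| * ρ ^ a := by
      intro y hy
      rw [Real.norm_of_nonneg (hpw y)]
      have h1 := norm_sub_le_of_mem_cube hy
      have h2 := norm_sub_norm_le x y
      have h3 := norm_sub_norm_le y x
      rw [norm_sub_rev] at h2
      have hx0 : 0 < ‖x‖ := lt_of_lt_of_le (by positivity) hfar
      have h4 : l ≤ s * l := le_mul_of_one_le_left hl.le hs1
      rw [← hs] at h1
      exact Real.rpow_le_rpow_abs_mul_rpow a (by linarith) hρ0 (by linarith) (by linarith)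
    have h := norm_setIntegral_le_of_norm_le_const (μ := volume)
      (volume_cube_ne_top x l).lt_top hbd
    rw [volume_real_cube x hl.le, Real.norm_of_nonneg (integral_nonneg hpw)] at h
    refine h.trans ?_
    have : 0 ≤ (4 * s) ^ d * (4 * s) ^ a * (1 + 2 * s) ^ |a| * J * l ^ d * ρ ^ a := by positivity
    nlinarith
  · have hsub : cube x l ⊆ Metric.ball 0 (4 * s * l) := by
      intro y hy
      rw [mem_ball_zero_iff]
      have h1 := norm_sub_le_of_mem_cube hy
      have h3 := norm_sub_norm_le y x
      rw [← hs] at h1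
      have : 0 < s * l := by positivity
      linarith
    have h1 : ∫ y in cube x l, powerWeight a y
        ≤ ∫ y in Metric.ball 0 (4 * s * l), powerWeight (d := d) a y :=
      setIntegral_mono_set ((hW.1.integrableOn_isCompact
        (isCompact_closedBall 0 (4 * s * l))).mono_set Metric.ball_subset_closedBall)
        (Filter.Eventually.of_forall hpw) hsub.eventuallyLE
    rw [setIntegral_ball_powerWeight a (by positivity), ← hJ] at h1
    have h2 : l ^ a ≤ (1 + 2 * s) ^ |a| * ρ ^ a :=
      Real.rpow_le_rpow_abs_mul_rpow a hl hρ0 (by linarith)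
        (by nlinarith [norm_nonneg x])
    rw [mul_pow _ l, Real.mul_rpow (by positivity) hl.le] at h1
    have h3 : 0 ≤ (3 : ℝ) ^ |a| * l ^ d * ρ ^ a := by positivity
    have h4 : 0 ≤ (4 * s) ^ d * (4 * s) ^ a * J * l ^ d := by positivity
    have h5 := mul_le_mul_of_nonneg_left h2 h4
    nlinarith

theorem abs_log_le_two_mul_rpow {t : ℝ} (ht : 0 ≤ t) :
    |Real.log t| ≤ 2 * (t ^ (1 / 2 : ℝ) + t ^ (-(1 / 2) : ℝ)) := by
  rcases ht.eq_or_lt with rfl | ht0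
  · simp only [Real.log_zero, abs_zero]
    positivity
  have h1 := Real.log_le_rpow_div ht (ε := 1 / 2) (by norm_num)
  have h2 := Real.log_le_rpow_div (inv_nonneg.2 ht) (ε := 1 / 2) (by norm_num)
  rw [Real.log_inv, Real.inv_rpow ht, ← Real.rpow_neg ht] at h2
  have h3 : 0 ≤ t ^ (1 / 2 : ℝ) := by positivity
  have h4 : 0 ≤ t ^ (-(1 / 2) : ℝ) := by positivity
  rw [abs_le]
  constructor <;> linarith

theorem integrableOn_log_norm_cube (hd : 0 < d) (x : EuclideanSpace ℝ (Fin d)) (l : ℝ) :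
    IntegrableOn (fun y : EuclideanSpace ℝ (Fin d) => Real.log ‖y‖) (cube x l) volume := by
  have hd1 : (1 : ℝ) ≤ d := by exact_mod_cast hd
  have h1 := (isWeight_powerWeight (d := d) hd (a := 1 / 2) (by linarith)).1.integrableOn_cube x l
  have h2 := (isWeight_powerWeight (d := d) hd (a := -(1 / 2)) (by linarith)).1.integrableOn_cube x l
  refine Integrable.mono' ((h1.add h2).const_mul 2)
    (Real.measurable_log.comp measurable_norm).aestronglyMeasurable
    (Filter.Eventually.of_forall fun y => ?_)
  exact abs_log_le_two_mul_rpow (norm_nonneg y)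

theorem log_powerWeight (a : ℝ) (y : EuclideanSpace ℝ (Fin d)) :
    Real.log (powerWeight a y) = a * Real.log ‖y‖ := by
  rcases (norm_nonneg y).eq_or_lt with h | h
  · rw [powerWeight, ← h, Real.log_zero, mul_zero]
    rcases eq_or_ne a 0 with rfl | ha
    · simp
    · simp [Real.zero_rpow ha]
  · exact Real.log_rpow h a

/-- The mean of log |y|^(-a) must be at most -a log(l + |x|) plus a constant. As |y|^(-a) need not
be locally integrable, the tangent inequality is applied to the small power |y|^(-aε) and the result
divided by ε. -/
theorem isAInfty_powerWeight (hd : 0 < d) {a : ℝ} (ha : -(d : ℝ) < a) :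
    IsAInfty (powerWeight (d := d) a) := by
  have hd1 : (1 : ℝ) ≤ d := by exact_mod_cast hd
  obtain ⟨C, hC0, hC⟩ := exists_setIntegral_cube_powerWeight_le hd ha
  -- Gives aε ≤ 1/2 < d, so the exponent -aε stays above -d.
  set ε := (2 * (|a| + 1))⁻¹ with hε
  have hε0 : 0 < ε := by positivity
  set s := -a * ε with hs
  have hsd : -(d : ℝ) < s := by
    have h1 : a * ε ≤ 1 / 2 := by
      rw [hε, ← div_eq_mul_inv, div_le_iff₀ (by positivity)]
      linarith [le_abs_self a]
    rw [hs]
    linarith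
  obtain ⟨D, hD0, hD⟩ := exists_setIntegral_cube_powerWeight_le hd hsd
  have hWs := isWeight_powerWeight hd hsd
  refine ⟨isWeight_powerWeight hd ha, Real.exp (D / ε) * C, fun x l hl => ?_⟩
  have hlog := integrableOn_log_norm_cube hd x l
  have hinv : ∀ y : EuclideanSpace ℝ (Fin d),
      Real.log (powerWeight a y)⁻¹ = -a * Real.log ‖y‖ := fun y => by
    rw [Real.log_inv, log_powerWeight, neg_mul]
  simp only [hinv]
  refine ⟨hlog.const_mul _, ?_⟩
  set ρ := l + ‖x‖ with hρ
  have hρ0 : 0 < ρ := by positivity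
  have hvol := volume_real_cube x hl.le
  have hm : 0 < l ^ d := by positivity
  rw [setAverage_eq, setAverage_eq, hvol, integral_const_mul, smul_eq_mul, smul_eq_mul]
  set L := ∫ y in cube x l, Real.log ‖y‖ with hL
  have h1 := setIntegral_log_le (volume_cube_ne_top x l) (hWs.1.integrableOn_cube x l) hWs.2
    (by simp only [log_powerWeight]; exact hlog.const_mul s) (a := ρ ^ s) (by positivity)
  simp only [log_powerWeight] at h1
  rw [integral_const_mul, hvol, Real.log_rpow hρ0, ← hL] at h1
  have h2 : (∫ y in cube x l, powerWeight s y) / ρ ^ s ≤ D * l ^ d := by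
    rw [div_le_iff₀ (by positivity)]
    exact hD x l hl
  have h3 : (l ^ d)⁻¹ * (-a * L) ≤ D / ε + -a * Real.log ρ := by
    rw [inv_mul_le_iff₀ hm]
    refine le_of_mul_le_mul_right ?_ hε0
    have h4 : l ^ d * (D / ε + -a * Real.log ρ) * ε = l ^ d * (D + s * Real.log ρ) := by
      rw [hs]
      field_simp
    rw [h4]
    have h5 : -a * L * ε = s * L := by rw [hs]; ring
    rw [h5]
    nlinarith
  have h6 : (l ^ d)⁻¹ * ∫ y in cube x l, powerWeight a y ≤ C * ρ ^ a := by
    rw [inv_mul_le_iff₀ hm]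
    linarith [hC x l hl]
  calc _ ≤ Real.exp (D / ε + -a * Real.log ρ) * (C * ρ ^ a) := by
        refine mul_le_mul (Real.exp_le_exp.2 h3) h6 ?_ (Real.exp_pos _).le
        exact mul_nonneg (by positivity) (integral_nonneg fun y => by
          unfold powerWeight; positivity)
    _ = _ := by
        have h7 : Real.exp (-a * Real.log ρ) * ρ ^ a = 1 := by
          rw [mul_comm (-a), ← Real.rpow_def_of_pos hρ0, ← Real.rpow_add hρ0, neg_add_cancel,
            Real.rpow_zero]
        rw [Real.exp_add]
        linear_combination (Real.exp (D / ε) * C) * h7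

theorem dualWeight_powerWeight {p : ℝ} (hp : 1 < p) (β : ℝ) :
    dualWeight p (powerWeight (d := d) (β * p)) = powerWeight (-(β * p.conjExponent)) := by
  funext x
  have hp0 : p ≠ 0 := by linarith
  rw [dualWeight, powerWeight, powerWeight, ← Real.rpow_mul (norm_nonneg x)]
  congr 1
  field_simp

/-- With ρ = l + |x|, the cube estimates bound the product by a constant times l^(α-d+d/p'+d/q)
ρ^(γ-β). Homogeneity makes this (l/ρ)^(β-γ), which is at most 1 because γ ≤ β. -/
theorem isApq_powerWeight (hd : 0 < d) {p q α β γ : ℝ} (hp : 1 < p) (hq : 1 < q)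
    (hγ : -(d / q) < γ) (hγβ : γ ≤ β) (hβ : β < d / p.conjExponent)
    (hhom : 1 / q + α / d + γ / d = 1 / p + β / d) :
    IsApq (d := d) p q α (powerWeight (β * p)) (powerWeight (γ * q)) := by
  have hpp := Real.HolderConjugate.conjExponent hp
  have hp'0 := hpp.symm.pos
  have hq0 : 0 < q := by linarith
  have hd0 : (0 : ℝ) < d := by exact_mod_cast hd
  set p' := p.conjExponent with hp'
  have h1 : -(d : ℝ) < -(β * p') := by
    rw [lt_div_iff₀ hp'0] at hβ
    linarith
  have h2 : -(d : ℝ) < γ * q := by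
    rw [← neg_div, div_lt_iff₀ hq0] at hγ
    exact hγ
  obtain ⟨C, hC0, hC⟩ := exists_setIntegral_cube_powerWeight_le hd h1
  obtain ⟨D, hD0, hD⟩ := exists_setIntegral_cube_powerWeight_le hd h2
  refine lt_of_le_of_lt (b := ENNReal.ofReal (C ^ (1 / p') * D ^ (1 / q))) ?_ ENNReal.ofReal_lt_top
  refine iSup_le fun x => iSup_le fun l => iSup_le fun hl => ?_
  rw [dualWeight_powerWeight hp]
  have hm := measurableSet_cube x l
  rw [← weightMeasure_apply hm, ← weightMeasure_apply hm,
    (isWeight_powerWeight hd h1).weightMeasure_eq_ofReal hm subset_rfl,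
    (isWeight_powerWeight hd h2).weightMeasure_eq_ofReal hm subset_rfl]
  set ρ := l + ‖x‖ with hρ
  have hρ0 : 0 < ρ := by positivity
  have e0 : volume (cube x l) ^ (α / d - 1) = ENNReal.ofReal (l ^ (α - d)) := by
    rw [volume_cube, ← ENNReal.ofReal_pow hl.le, ENNReal.ofReal_rpow_of_pos (by positivity),
      ← Real.rpow_natCast, ← Real.rpow_mul hl.le]
    congr 2
    field_simp
  have e1 : ENNReal.ofReal (∫ y in cube x l, powerWeight (-(β * p')) y) ^ (1 / p')
      ≤ ENNReal.ofReal ((C * l ^ d * ρ ^ (-(β * p'))) ^ (1 / p')) := by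
    rw [← ENNReal.ofReal_rpow_of_nonneg (by positivity) (by positivity)]
    exact ENNReal.rpow_le_rpow (ENNReal.ofReal_le_ofReal (hC x l hl)) (by positivity)
  have e2 : ENNReal.ofReal (∫ y in cube x l, powerWeight (γ * q) y) ^ (1 / q)
      ≤ ENNReal.ofReal ((D * l ^ d * ρ ^ (γ * q)) ^ (1 / q)) := by
    rw [← ENNReal.ofReal_rpow_of_nonneg (by positivity) (by positivity)]
    exact ENNReal.rpow_le_rpow (ENNReal.ofReal_le_ofReal (hD x l hl)) (by positivity)
  rw [e0]
  refine (mul_le_mul' (mul_le_mul_right e1 _) e2).trans ?_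
  rw [← ENNReal.ofReal_mul (by positivity), ← ENNReal.ofReal_mul (by positivity)]
  refine ENNReal.ofReal_le_ofReal ?_
  have f1 : (C * l ^ d * ρ ^ (-(β * p'))) ^ (1 / p') = C ^ (1 / p') * l ^ (d / p') * ρ ^ (-β) := by
    rw [Real.mul_rpow (by positivity) (by positivity), Real.mul_rpow hC0.le (by positivity),
      ← Real.rpow_natCast, ← Real.rpow_mul hl.le, ← Real.rpow_mul hρ0.le]
    congr 2
    · congr 1
      field_simp
    · field_simp
  have f2 : (D * l ^ d * ρ ^ (γ * q)) ^ (1 / q) = D ^ (1 / q) * l ^ (d / q) * ρ ^ γ := by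
    rw [Real.mul_rpow (by positivity) (by positivity), Real.mul_rpow hD0.le (by positivity),
      ← Real.rpow_natCast, ← Real.rpow_mul hl.le, ← Real.rpow_mul hρ0.le]
    congr 2
    · congr 1
      field_simp
    · field_simp
  have hexp : α - d + d / p' + d / q = β - γ := by
    have h3 := hpp.inv_add_inv_eq_one
    rw [div_eq_mul_inv (d : ℝ) p', div_eq_mul_inv (d : ℝ) q, ← eq_sub_iff_add_eq'.2 h3 |>.symm]
    field_simp at hhom ⊢
    linarith
  have f3 : l ^ (α - d) * l ^ (d / p') * l ^ (d / q) * (ρ ^ (-β) * ρ ^ γ) ≤ 1 := by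
    rw [← Real.rpow_add hl, ← Real.rpow_add hl, hexp, ← Real.rpow_add hρ0,
      show -β + γ = -(β - γ) by ring, Real.rpow_neg hρ0.le, ← div_eq_mul_inv,
      div_le_one (by positivity)]
    exact Real.rpow_le_rpow hl.le (by linarith [norm_nonneg x]) (by linarith)
  rw [f1, f2]
  calc _ = C ^ (1 / p') * D ^ (1 / q) *
        (l ^ (α - d) * l ^ (d / p') * l ^ (d / q) * (ρ ^ (-β) * ρ ^ γ)) := by ring
    _ ≤ C ^ (1 / p') * D ^ (1 / q) * 1 := by gcongr
    _ = _ := mul_one _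

theorem aestronglyMeasurable_norm_rpow_mul (b : ℝ) {f : EuclideanSpace ℝ (Fin d) → ℂ}
    (hf : AEStronglyMeasurable f volume) :
    AEStronglyMeasurable (fun x => ((‖x‖ ^ b : ℝ) : ℂ) * f x) volume :=
  (Complex.measurable_ofReal.comp (measurable_norm.pow_const b)).aestronglyMeasurable.mul hf

theorem aestronglyMeasurable_of_norm_rpow_mul (hd : 0 < d) {b : ℝ}
    {f : EuclideanSpace ℝ (Fin d) → ℂ}
    (hf : AEStronglyMeasurable (fun x => ((‖x‖ ^ b : ℝ) : ℂ) * f x) volume) :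
    AEStronglyMeasurable f volume := by
  refine (aestronglyMeasurable_norm_rpow_mul (-b) hf).congr ?_
  filter_upwards [ae_ne_zero_euclideanSpace hd] with x hx
  rw [← mul_assoc, ← Complex.ofReal_mul, ← Real.rpow_add (norm_pos_iff.2 hx)]
  simp

theorem eLpNorm_weightMeasure_powerWeight {r : ℝ} (hr : 0 < r) (b : ℝ)
    {f : EuclideanSpace ℝ (Fin d) → ℂ} (hf : AEStronglyMeasurable f volume) :
    eLpNorm f (ENNReal.ofReal r) (weightMeasure (powerWeight (b * r)))
      = eLpNorm (fun x => ((‖x‖ ^ b : ℝ) : ℂ) * f x) (ENNReal.ofReal r) volume := by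
  rw [eLpNorm_eq_lintegral_rpow_enorm_toReal (ENNReal.ofReal_pos.2 hr).ne' ENNReal.ofReal_ne_top,
    eLpNorm_eq_lintegral_rpow_enorm_toReal (ENNReal.ofReal_pos.2 hr).ne' ENNReal.ofReal_ne_top,
    ENNReal.toReal_ofReal hr.le, weightMeasure, lintegral_withDensity_eq_lintegral_mul₀
      (measurable_powerWeight _).ennreal_ofReal.aemeasurable (hf.enorm.pow_const _)]
  congr 1
  refine lintegral_congr fun x => ?_
  rw [Pi.mul_apply, enorm_mul, ENNReal.mul_rpow_of_nonneg _ _ hr.le, powerWeight,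
    ← ofReal_norm (((‖x‖ ^ b : ℝ) : ℂ)), Complex.norm_real, Real.norm_of_nonneg (by positivity),
    ENNReal.ofReal_rpow_of_nonneg (by positivity) hr.le, ← Real.rpow_mul (norm_nonneg x)]

end PowerWeight

theorem theorem3p4 (d : ℕ) (p q α : ℝ) (hp : 1 < p) (hpq : p ≤ q) (hα : 0 < α) (hαd : α < d) :
    -- the two-weight inequality
    (∀ v w : EuclideanSpace ℝ (Fin d) → ℝ, IsWeight v → IsWeight w → IsApq p q α v w →
      IsAInfty (dualWeight p v) → IsAInfty w →
      ∃ C : ℝ≥0, ∀ f : EuclideanSpace ℝ (Fin d) → ℂ,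
        MemLp f (ENNReal.ofReal p) (weightMeasure v) →
        (∀ᵐ x, Integrable (rieszIntegrand α f x) volume) ∧
        MemLp (rieszPotential α f) (ENNReal.ofReal q) (weightMeasure w) ∧
        eLpNorm (rieszPotential α f) (ENNReal.ofReal q) (weightMeasure w)
          ≤ C * eLpNorm f (ENNReal.ofReal p) (weightMeasure v)) ∧
    -- power weights satisfy its hypotheses, and it contains the Stein-Weiss inequality
    (∀ β γ : ℝ, -(d / q) < γ → γ ≤ β → β < d / p.conjExponent →
      1 / q + α / d + γ / d = 1 / p + β / d →
      (IsWeight (d := d) (powerWeight (β * p)) ∧ IsWeight (d := d) (powerWeight (γ * q)) ∧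
        IsApq (d := d) p q α (powerWeight (β * p)) (powerWeight (γ * q)) ∧
        IsAInfty (d := d) (dualWeight p (powerWeight (β * p))) ∧
        IsAInfty (d := d) (powerWeight (γ * q))) ∧
      ∃ C : ℝ≥0, ∀ f : EuclideanSpace ℝ (Fin d) → ℂ,
        MemLp (fun x => ((‖x‖ ^ β : ℝ) : ℂ) * f x) (ENNReal.ofReal p) volume →
        (∀ᵐ x, Integrable (rieszIntegrand α f x) volume) ∧
        MemLp (fun x => ((‖x‖ ^ γ : ℝ) : ℂ) * rieszPotential α f x) (ENNReal.ofReal q) volume ∧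
        eLpNorm (fun x => ((‖x‖ ^ γ : ℝ) : ℂ) * rieszPotential α f x) (ENNReal.ofReal q) volume
          ≤ C * eLpNorm (fun x => ((‖x‖ ^ β : ℝ) : ℂ) * f x) (ENNReal.ofReal p) volume) := by
  have hd : 0 < d := by
    have : (0 : ℝ) < d := hα.trans hαd
    exact_mod_cast this
  have hd0 : (0 : ℝ) < d := by exact_mod_cast hd
  have hp0 : 0 < p := by linarith
  have hq : 1 < q := by linarith
  have hq0 : 0 < q := by linarith
  refine ⟨fun v w hv hw hApq hσ hw' =>
    exists_eLpNorm_rieszPotential_le hp hpq hα hαd hv hw hApq hσ hw', ?_⟩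
  intro β γ hγ hγβ hβ hhom
  have hp'0 := (Real.HolderConjugate.conjExponent hp).symm.pos
  -- Local integrability of v is not assumed: the homogeneity relation with γ/d > -1/q and α > 0
  -- forces β/d > -1/p.
  have hβp : -(d : ℝ) < β * p := by
    have h1 : -(1 / p) < β / d := by
      have h2 : -(1 / q) < γ / d := by
        rw [lt_div_iff₀ hd0]
        calc -(1 / q) * d = -(d / q) := by ring
          _ < γ := hγ
      have h3 : 0 < α / d := by positivity
      linarith
    rw [lt_div_iff₀ hd0] at h1
    have h4 := mul_lt_mul_of_pos_right h1 hp0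
    have h5 : -(1 / p) * d * p = -(d : ℝ) := by field_simp
    linarith
  have hγq : -(d : ℝ) < γ * q := by
    rw [← neg_div, div_lt_iff₀ hq0] at hγ
    exact hγ
  have hβp' : -(d : ℝ) < -(β * p.conjExponent) := by
    rw [lt_div_iff₀ hp'0] at hβ
    linarith
  have hv := isWeight_powerWeight hd hβp
  have hw := isWeight_powerWeight hd hγq
  have hApq := isApq_powerWeight hd hp hq hγ hγβ hβ hhom
  have hσ : IsAInfty (dualWeight p (powerWeight (d := d) (β * p))) := by
    rw [dualWeight_powerWeight hp]
    exact isAInfty_powerWeight hd hβp'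
  have hw' := isAInfty_powerWeight hd hγq
  refine ⟨⟨hv, hw, hApq, hσ, hw'⟩, ?_⟩
  obtain ⟨C, hC⟩ := exists_eLpNorm_rieszPotential_le hp hpq hα hαd hv hw hApq hσ hw'
  refine ⟨C, fun f hf => ?_⟩
  -- Only |x|^β f is assumed measurable; dividing by the power off the origin recovers f.
  have hfm := aestronglyMeasurable_of_norm_rpow_mul hd hf.1
  have hRm := aestronglyMeasurable_rieszPotential α hfm
  have hfp := eLpNorm_weightMeasure_powerWeight hp0 β hfm
  have hRq := eLpNorm_weightMeasure_powerWeight hq0 γ hRm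
  obtain ⟨h1, h2, h3⟩ := hC f ⟨hfm.mono_ac (weightMeasure_absolutelyContinuous _), hfp ▸ hf.2⟩
  rw [hfp, hRq] at h3
  exact ⟨h1, ⟨aestronglyMeasurable_norm_rpow_mul γ hRm, hRq ▸ h2.2⟩, h3⟩
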